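/- **Corollary 3.1.** *Setting.* Let $d,q\ge 1$, let $\mathcal I\subset\mathbb R^d$ and $\Theta\subset\mathbb R^q$ be compact, and let $G$ be a finite Borel measure on $\mathbb R^d$ carried by $\mathcal I$. Consider the Berkson model $$Y=\mu(X)+\varepsilon,\qquad X=Z+\eta,$$ where $Z,\eta$ ($\mathbb R^d$-valued) and $\varepsilon$ (real-valued) are mutually independent, $E\varepsilon=0$, and $Z,\eta$ have Lebesgue densities $f_Z,f_\eta$. Let $\{m_\theta:\theta\in\Theta\}$ be a family of measurable functions $\mathbb R^d\to\mathbb R$, and write, for $z\in\mathbb R^d$, $$H_\theta(z)=E[m_\theta(X)\mid Z=z]=\int m_\theta(x)f_\eta(x-z)\,dx,\qquad H(z)=E[Y\mid Z=z]=\int \mu(x)f_\eta(x-z)\,dx,$$ $$\tau^2(z)=E[(m_{\theta_0}(X)-H_{\theta_0}(Z))^2\mid Z=z]=\int (m_{\theta_0}(x)-H_{\theta_0}(z))^2f_\eta(x-z)\,dx .$$ *Assumptions.* - ($\mathcal H_0$) $\theta_0\in\Theta$ and $\mu(X)=m_{\theta_0}(X)$ almost surely. - (e1) $(Z_i,Y_i)$,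 $i\ge1$, are i.i.d. copies of $(Z,Y)$, and $\int H^2\,dG<\infty$. - (e2) $0<\operatorname{Var}\varepsilon<\infty$, $E\,m_{\theta_0}(X)^2<\infty$, and $\tau^2$ is $G$-a.e. continuous on $\mathcal I$. - (f1) $f_Z$ is uniformly continuous on a neighbourhood of $\mathcal I$, and bounded below on $\mathcal I$ by a positive constant. - (m1) For each $\theta\in\Theta$, $m_\theta$ is continuous at Lebesgue-almost every point. - (m2) If $\theta_1,\theta_2\in\Theta$ and $H_{\theta_1}=H_{\theta_2}$ $G$-a.e., then $\theta_1=\theta_2$. - (m3) There are a positive continuous function $\ell$ on $\mathcal I$ and $0<\beta\le1$ with $|H_{\theta_2}(z)-H_{\theta_1}(z)|\le\|\theta_2-\theta_1\|^\beta\ell(z)$ for all $\theta_1,\theta_2\in\Theta$, $z\in\mathcal I$. - (b) There is an open set $U\supseteq\mathcal I$ with $\sup_{\theta\in\Theta,\,z\in U}\int m_\theta(x)^2f_\eta(x-z)\,dx<\infty$ (for example, $m_\theta(x)$ is bounded in $(\theta,x)$). - (k) $K,K^*$ are nonnegative, symmetric, square integrable probability densities on $[-1,1]^d$ (extended by $0$),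 and $K^*$ is Lipschitz on $[-1,1]^d$. - (h1), (h2) The bandwidths $h_n>0$ satisfy $h_n\to0$ and $nh_n^{2d}\to\infty$. - The bandwidths $w_n>0$ are of the exact order $(\log n/n)^{1/(d+4)}$, i.e. $w_n/(\log n/n)^{1/(d+4)}$ is eventually bounded away from $0$ and $\infty$. *Estimators.* Put $K_h(x)=K(x/h)/h^d$, $K^*_w(x)=K^*(x/w)/w^d$, $\hat f_n(z)=\frac1n\sum_{i=1}^nK^*_{w_n}(z-Z_i)$, $$M_n^*(\theta)=\int\Big[\frac1{n\hat f_n(z)}\sum_{i=1}^nK_{h_n}(z-Z_i)Y_i-H_\theta(z)\Big]^2dG(z),$$ $$M_n(\theta)=\int\Big[\frac1{n\hat f_n(z)}\sum_{i=1}^nK_{h_n}(z-Z_i)\,(Y_i-H_\theta(Z_i))\Big]^2dG(z).$$ For all sufficiently large $n$, let $\theta_n^*$ and $\hat\theta_n$ almost surely be minimizers over $\Theta$ of $M_n^*$ and of $M_n$, respectively. *Conclusion.* $\theta_n^*\to\theta_0$ and $\hat\theta_n\to\theta_0$ in probability as $n\to\infty$. -/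

import Mathlib

open MeasureTheory ProbabilityTheory Filter Topology

/-- `f` is a (pointwise chosen, nonnegative, measurable) Lebesgue density of the random vector `X`. -/
def HasLebesgueDensity {Ω : Type*} [MeasurableSpace Ω] (P : Measure Ω) {d : ℕ}
    (X : Ω → Fin d → ℝ) (f : (Fin d → ℝ) → ℝ) : Prop :=
  Measurable f ∧ (∀ x, 0 ≤ f x) ∧
    P.map X = (volume : Measure (Fin d → ℝ)).withDensity (fun x => ENNReal.ofReal (f x))

/-- Mutual independence of three random elements: `A` is independent of the pair `(B, C)`, and `B`
and `C` are independent. -/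
def MutuallyIndependent₃ {Ω α β γ : Type*} [MeasurableSpace Ω] [MeasurableSpace α]
    [MeasurableSpace β] [MeasurableSpace γ] (P : Measure Ω)
    (A : Ω → α) (B : Ω → β) (C : Ω → γ) : Prop :=
  IndepFun A (fun ω => (B ω, C ω)) P ∧ IndepFun B C P

/-- `E[g(X) | Z = z]` when `X = Z + η` with `η` independent of `Z` and with density `fη`, that is,
`∫ g(x) fη(x - z) dx`.  With `g = m_θ` this is `H_θ(z)`, with `g = μ` it is `H(z) = E[Y | Z = z]`. -/
noncomputable def condMean {d : ℕ} (fη : (Fin d → ℝ) → ℝ) (g : (Fin d → ℝ) → ℝ)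
    (z : Fin d → ℝ) : ℝ :=
  ∫ x, g x * fη (x - z)

/-- `τ²(z) = E[(g(X) - E[g(X) | Z])² | Z = z]`. -/
noncomputable def berksonTauSq {d : ℕ} (fη : (Fin d → ℝ) → ℝ) (g : (Fin d → ℝ) → ℝ)
    (z : Fin d → ℝ) : ℝ :=
  condMean fη (fun x => (g x - condMean fη g z) ^ 2) z

/-- `E[g(X)² | Z = z]` as an extended nonnegative number (`∞` if the moment is infinite). -/
noncomputable def condSecondMoment {d : ℕ} (fη : (Fin d → ℝ) → ℝ) (g : (Fin d → ℝ) → ℝ)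
    (z : Fin d → ℝ) : ENNReal :=
  ∫⁻ x, ENNReal.ofReal (g x ^ 2 * fη (x - z))

/-- A symmetric, square integrable probability density on `[-1, 1]^d`, extended by `0`. -/
structure IsKernel {d : ℕ} (K : (Fin d → ℝ) → ℝ) : Prop where
  measurable : Measurable K
  nonneg : ∀ x, 0 ≤ K x
  eq_zero_off_cube : ∀ x, x ∉ Set.Icc (-1 : Fin d → ℝ) 1 → K x = 0
  symmetric : ∀ x, K (-x) = K x
  integral_eq_one : ∫ x, K x = 1
  sq_integrable : Integrable (fun x => K x ^ 2)

/-- `K_h(x) = K(x / h) / h^d`. -/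
noncomputable def scaledKernel {d : ℕ} (K : (Fin d → ℝ) → ℝ) (h : ℝ) (x : Fin d → ℝ) : ℝ :=
  K (h⁻¹ • x) / h ^ d

/-- The kernel average `n⁻¹ ∑ᵢ K_h(z - Zᵢ) aᵢ` over a sample of size `n`. -/
noncomputable def kernelAverage {d : ℕ} (K : (Fin d → ℝ) → ℝ) (h : ℝ) (n : ℕ)
    (Z : ℕ → Fin d → ℝ) (a : ℕ → ℝ) (z : Fin d → ℝ) : ℝ :=
  (∑ i ∈ Finset.range n, scaledKernel K h (z - Z i) * a i) / n

/-- The kernel density estimator `n⁻¹ ∑ᵢ K_w(z - Zᵢ)`. -/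
noncomputable def kernelDensityEstimator {d : ℕ} (K : (Fin d → ℝ) → ℝ) (w : ℝ) (n : ℕ)
    (Z : ℕ → Fin d → ℝ) (z : Fin d → ℝ) : ℝ :=
  kernelAverage K w n Z (fun _ => 1) z

/-- The distance
`M*_n(θ) = ∫ [ (n f̂_w(z))⁻¹ ∑ᵢ K_h(z - Zᵢ) Yᵢ - H_θ(z) ]² dG(z)`, for `Hθ = H_θ`. -/
noncomputable def distStar {d : ℕ} (K Kstar : (Fin d → ℝ) → ℝ) (h w : ℝ) (n : ℕ)
    (G : Measure (Fin d → ℝ)) (Z : ℕ → Fin d → ℝ) (Y : ℕ → ℝ) (Hθ : (Fin d → ℝ) → ℝ) : ENNReal :=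
  ∫⁻ z, ENNReal.ofReal
    ((kernelAverage K h n Z Y z / kernelDensityEstimator Kstar w n Z z - Hθ z) ^ 2) ∂G

/-- The distance
`M_n(θ) = ∫ [ (n f̂_w(z))⁻¹ ∑ᵢ K_h(z - Zᵢ) (Yᵢ - H_θ(Zᵢ)) ]² dG(z)`, for `Hθ = H_θ`. -/
noncomputable def distHat {d : ℕ} (K Kstar : (Fin d → ℝ) → ℝ) (h w : ℝ) (n : ℕ)
    (G : Measure (Fin d → ℝ)) (Z : ℕ → Fin d → ℝ) (Y : ℕ → ℝ) (Hθ : (Fin d → ℝ) → ℝ) : ENNReal :=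
  ∫⁻ z, ENNReal.ofReal
    ((kernelAverage K h n Z (fun i => Y i - Hθ (Z i)) z /
      kernelDensityEstimator Kstar w n Z z) ^ 2) ∂G

/-- `t` is a minimizer of `M` over `Θ`, i.e. `t` is a value of `arg min {M(θ) : θ ∈ Θ}`. -/
def IsArgMin {T : Type*} (M : T → ENNReal) (Θ : Set T) (t : T) : Prop :=
  t ∈ Θ ∧ ∀ θ ∈ Θ, M t ≤ M θ

/-!
Write `H θ` for `condMean fη (m θ)` and `H₀` for `H θ₀`. The integrands of both criteria approximate
`H₀ - H θ`, uniformly over `θ ∈ Θ`. Let `S` be the kernel average of the centred noise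
`Yᵢ - H₀(Zᵢ)`, `D` the density estimator with kernel `K` and bandwidth `h`, and `f̂` the one with
kernel `Kstar` and bandwidth `w`. As `K_h` has support in a cube of radius `h`, the integrands are
`(S + D H₀ + r) / f̂ - H θ` and `(S + D (H₀ - H θ) + r θ) / f̂`, where `|r|, |r θ| ≤ 2 e D` with `e` the
oscillation at scale `h` of the functions `H θ`. So, wherever `f̂ ≥ c₀ > 0`, both differ from
`H₀ - H θ` by at most a constant times `|S| + |D - f_Z| + |f̂ - f_Z| + e` (`sq_ratio_sub_le`), a bound
which does not involve `θ`. Comparing the values of a criterion at its minimizer `t` and at `θ₀`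
yields `∫ (H₀ - H t)² dG ≤ 4 ∫ (error)² dG` (`lintegral_sq_sub_le_of_isArgMin`), and by compactness
of `Θ` and identifiability the left-hand side is bounded below while `t` stays away from `θ₀`
(`exists_separation`). No uniform law of large numbers is needed.

Three facts make the error small.

* The functions `H θ` are equicontinuous near `I`, uniformly in `θ`, because translation is continuous
  in `L¹` for the density of `η` and the conditional second moments are bounded
  (`condMean_equicontinuous`). This covers points `Zᵢ` outside of `I`, where the Hölder condition in
  `θ` says nothing.
* The mean squares of `S`, `D - f_Z` and `f̂ - f_Z` tend to zero uniformly on `I`: the variances are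
  `O(1 / (n h ^ d))` and `O(1 / (n w ^ d))`, and the bias is bounded by the oscillation of `f_Z`
  (`tendsto_lintegral_kernelErrors`).
* With probability tending to one `f̂` is bounded below on all of `I`. The kernel `Kstar` exceeds some
  `a > 0` on a ball, so `f̂` dominates a multiple of the number of observations in a ball of radius
  proportional to `w`; a Chernoff bound controls these counts at the points of a net of cardinality
  `O(w ^ (-d))` (`exists_tendsto_measure_not_lt_kernelDensityEstimator`).
-/

/-! ### Conditional means under the Berkson model -/

namespace HasLebesgueDensity

variable {Ω : Type*} [MeasurableSpace Ω] {P : Measure Ω} {d : ℕ}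
  {X : Ω → Fin d → ℝ} {f : (Fin d → ℝ) → ℝ}

lemma lintegral_map (hf : HasLebesgueDensity P X f) {g : (Fin d → ℝ) → ENNReal}
    (hg : Measurable g) :
    ∫⁻ x, g x ∂(P.map X) = ∫⁻ x, g x * ENNReal.ofReal (f x) := by
  rw [hf.2.2, lintegral_withDensity_eq_lintegral_mul _ hf.1.ennreal_ofReal hg]
  simp [mul_comm]

lemma integral_map (hf : HasLebesgueDensity P X f) (g : (Fin d → ℝ) → ℝ) :
    ∫ x, g x ∂(P.map X) = ∫ x, g x * f x := by
  rw [hf.2.2, integral_withDensity_eq_integral_toReal_smul hf.1.ennreal_ofReal (by simp)]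
  simp [hf.2.1, mul_comm]

lemma lintegral_eq_one [IsProbabilityMeasure P] (hf : HasLebesgueDensity P X f)
    (hX : Measurable X) : ∫⁻ x, ENNReal.ofReal (f x) = 1 := by
  have := hf.lintegral_map (g := fun _ => 1) measurable_const
  have : IsProbabilityMeasure (P.map X) := Measure.isProbabilityMeasure_map hX.aemeasurable
  simp_all

lemma integrable [IsProbabilityMeasure P] (hf : HasLebesgueDensity P X f)
    (hX : Measurable X) : Integrable f := by
  refine ⟨hf.1.aestronglyMeasurable, ?_⟩
  rw [hasFiniteIntegral_iff_ofReal (Eventually.of_forall hf.2.1), hf.lintegral_eq_one hX]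
  exact ENNReal.one_lt_top

lemma integral_eq_one [IsProbabilityMeasure P] (hf : HasLebesgueDensity P X f)
    (hX : Measurable X) : ∫ x, f x = 1 := by
  rw [integral_eq_lintegral_of_nonneg_ae (Eventually.of_forall hf.2.1)
    hf.1.aestronglyMeasurable, hf.lintegral_eq_one hX, ENNReal.toReal_one]

lemma condMean_eq (hf : HasLebesgueDensity P X f) (g : (Fin d → ℝ) → ℝ) (y : Fin d → ℝ) :
    condMean f g y = ∫ u, g (y + u) ∂(P.map X) := by
  rw [hf.integral_map (fun u => g (y + u)), condMean,
    ← integral_add_left_eq_self (fun x => g x * f (x - y)) y]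
  simp

lemma condSecondMoment_eq (hf : HasLebesgueDensity P X f) {g : (Fin d → ℝ) → ℝ}
    (hg : Measurable g) (y : Fin d → ℝ) :
    condSecondMoment f g y = ∫⁻ u, ENNReal.ofReal (g (y + u) ^ 2) ∂(P.map X) := by
  rw [hf.lintegral_map (g := fun u => ENNReal.ofReal (g (y + u) ^ 2)) (by fun_prop),
    condSecondMoment,
    ← lintegral_add_left_eq_self (fun x => ENNReal.ofReal (g x ^ 2 * f (x - y))) y]
  simp [ENNReal.ofReal_mul (sq_nonneg _)]

end HasLebesgueDensity

/-- Translation is continuous in `L¹`. -/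
lemma tendsto_integral_abs_sub_translate {d : ℕ} {f : (Fin d → ℝ) → ℝ} (hf : Integrable f) :
    Tendsto (fun c : Fin d → ℝ => ∫ x, |f (x + c) - f x|) (𝓝 0) (𝓝 0) := by
  have hfp : MemLp f 1 volume := memLp_one_iff_integrable.2 hf
  let g : (Fin d → ℝ) → C(Fin d → ℝ, Fin d → ℝ) := fun c => ⟨fun x => x + c, by fun_prop⟩
  have hg : Continuous g := ContinuousMap.continuous_of_continuous_uncurry _ (by
    simp only [g]; unfold Function.uncurry; simp; fun_prop)
  have hgm : ∀ c, MeasurePreserving (g c) volume volume :=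
    fun c => measurePreserving_add_right volume c
  have key : Continuous fun c => Lp.compMeasurePreserving (g c) (hgm c) (hfp.toLp f) :=
    continuous_const.compMeasurePreservingLp hg hgm ENNReal.one_ne_top
  have h2 := ((key.sub (continuous_const (y := hfp.toLp f))).norm).tendsto 0
  have h3 : ∀ c, ‖Lp.compMeasurePreserving (g c) (hgm c) (hfp.toLp f) - hfp.toLp f‖
      = ∫ x, |f (x + c) - f x| := by
    intro c
    rw [Lp.toLp_compMeasurePreserving, ← MemLp.toLp_sub, Lp.norm_toLp,
      eLpNorm_one_eq_lintegral_enorm, ← integral_norm_eq_lintegral_enorm]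
    · rfl
    · exact ((hfp.comp_measurePreserving (hgm c)).sub hfp).aestronglyMeasurable
  convert h2.congr h3 using 2
  exact (by simp : (0 : ℝ) = ∫ x, |f (x + 0) - f x|).trans (h3 0).symm

section CondMean

variable {d : ℕ} {f g : (Fin d → ℝ) → ℝ}

lemma integrable_sq_mul_of_condSecondMoment_lt_top (hfm : Measurable f) (hf0 : ∀ x, 0 ≤ f x)
    (hg : Measurable g) {z : Fin d → ℝ} (h : condSecondMoment f g z < ⊤) :
    Integrable fun x => g x ^ 2 * f (x - z) := by
  refine ⟨by fun_prop, ?_⟩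
  rwa [hasFiniteIntegral_iff_ofReal
    (Eventually.of_forall fun x => mul_nonneg (sq_nonneg _) (hf0 _))]

lemma integrable_mul_of_condSecondMoment_lt_top (hfm : Measurable f) (hf0 : ∀ x, 0 ≤ f x)
    (hfi : Integrable f)
    (hg : Measurable g) {z : Fin d → ℝ} (h : condSecondMoment f g z < ⊤) :
    Integrable fun x => g x * f (x - z) := by
  refine ((integrable_sq_mul_of_condSecondMoment_lt_top hfm hf0 hg h).add
    (hfi.comp_sub_right z)).mono' (by fun_prop) (Eventually.of_forall fun x => ?_)
  rw [Real.norm_eq_abs, abs_mul, abs_of_nonneg (hf0 _)]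
  have h1 : |g x| ≤ g x ^ 2 + 1 := by
    rw [← sq_abs]; nlinarith [sq_nonneg (|g x| - 1), abs_nonneg (g x)]
  have := mul_le_mul_of_nonneg_right h1 (hf0 (x - z))
  simp only [Pi.add_apply]
  linarith

lemma integral_sq_mul_le_of_condSecondMoment_le (hfm : Measurable f) (hf0 : ∀ x, 0 ≤ f x)
    (hg : Measurable g) {z : Fin d → ℝ} {B : ℝ} (hB : 0 ≤ B)
    (h : condSecondMoment f g z ≤ ENNReal.ofReal B) :
    ∫ x, g x ^ 2 * f (x - z) ≤ B := by
  rw [integral_eq_lintegral_of_nonneg_ae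
    (Eventually.of_forall fun x => mul_nonneg (sq_nonneg _) (hf0 _)) (by fun_prop)]
  exact ENNReal.toReal_le_of_le_ofReal hB h

/-- The conditional Jensen inequality, by nonnegativity of the conditional variance. -/
lemma sq_condMean_le (hfm : Measurable f) (hf0 : ∀ x, 0 ≤ f x) (hfi : Integrable f)
    (hf1 : ∫ x, f x = 1) (hg : Measurable g) {z : Fin d → ℝ} {B : ℝ} (hB : 0 ≤ B)
    (h : condSecondMoment f g z ≤ ENNReal.ofReal B) :
    condMean f g z ^ 2 ≤ B := by
  have htop := h.trans_lt ENNReal.ofReal_lt_top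
  have i1 := integrable_sq_mul_of_condSecondMoment_lt_top hfm hf0 hg htop
  have i2 := integrable_mul_of_condSecondMoment_lt_top hfm hf0 hfi hg htop
  have i3 := hfi.comp_sub_right z
  set a := condMean f g z with ha
  have h0 : 0 ≤ ∫ x, (g x - a) ^ 2 * f (x - z) :=
    integral_nonneg fun x => mul_nonneg (sq_nonneg _) (hf0 _)
  have h1 : ∫ x, (g x - a) ^ 2 * f (x - z)
      = (∫ x, g x ^ 2 * f (x - z)) - 2 * a * a + a ^ 2 * 1 := by
    have e : ∀ x, (g x - a) ^ 2 * f (x - z)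
        = g x ^ 2 * f (x - z) - 2 * a * (g x * f (x - z)) + a ^ 2 * f (x - z) := by
      intro x; ring
    simp_rw [e]
    have i4 : Integrable fun x => g x ^ 2 * f (x - z) - 2 * a * (g x * f (x - z)) :=
      i1.sub (i2.const_mul _)
    rw [integral_add i4 (i3.const_mul _),
      integral_sub i1 (i2.const_mul _), integral_const_mul, integral_const_mul,
      integral_sub_right_eq_self f z, hf1]
    rfl
  have h2 := integral_sq_mul_le_of_condSecondMoment_le hfm hf0 hg hB h
  nlinarith

/-- A truncation estimate: where `|g| ≤ M` the `L¹` modulus of translation of `f` controls the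
increment, and elsewhere `|g| ≤ g² / M`. -/
lemma abs_condMean_sub_le (hfm : Measurable f) (hf0 : ∀ x, 0 ≤ f x) (hfi : Integrable f)
    (hg : Measurable g) {z y : Fin d → ℝ} {B M : ℝ} (hB : 0 ≤ B) (hM : 0 < M)
    (hz : condSecondMoment f g z ≤ ENNReal.ofReal B)
    (hy : condSecondMoment f g y ≤ ENNReal.ofReal B) :
    |condMean f g y - condMean f g z| ≤ M * (∫ x, |f (x + (z - y)) - f x|) + 2 * B / M := by
  have hzt := hz.trans_lt ENNReal.ofReal_lt_top
  have hyt := hy.trans_lt ENNReal.ofReal_lt_top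
  have iz := integrable_sq_mul_of_condSecondMoment_lt_top hfm hf0 hg hzt
  have iy := integrable_sq_mul_of_condSecondMoment_lt_top hfm hf0 hg hyt
  have bz := integral_sq_mul_le_of_condSecondMoment_le hfm hf0 hg hB hz
  have bdy := integral_sq_mul_le_of_condSecondMoment_le hfm hf0 hg hB hy
  have jz := hfi.comp_sub_right z
  have jy := hfi.comp_sub_right y
  unfold condMean
  rw [← integral_sub (integrable_mul_of_condSecondMoment_lt_top hfm hf0 hfi hg hyt)
    (integrable_mul_of_condSecondMoment_lt_top hfm hf0 hfi hg hzt)]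
  have hshift : ∫ x, |f (x + (z - y)) - f x| = ∫ x, |f (x - y) - f (x - z)| := by
    rw [← integral_sub_right_eq_self (fun x => |f (x + (z - y)) - f x|) z]
    congr 1; ext x; congr 3; abel
  have habs : Integrable fun x => |f (x - y) - f (x - z)| := (jy.sub jz).abs
  have isum : Integrable fun x => g x ^ 2 * f (x - y) + g x ^ 2 * f (x - z) := iy.add iz
  calc |∫ x, (g x * f (x - y) - g x * f (x - z))|
      ≤ ∫ x, |g x * f (x - y) - g x * f (x - z)| := abs_integral_le_integral_abs
    _ ≤ ∫ x, (M * |f (x - y) - f (x - z)|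
          + M⁻¹ * (g x ^ 2 * f (x - y) + g x ^ 2 * f (x - z))) := by
        refine integral_mono_of_nonneg (Eventually.of_forall fun x => abs_nonneg _)
          ((habs.const_mul M).add (isum.const_mul _)) (Eventually.of_forall fun x => ?_)
        simp only
        have ha := hf0 (x - y)
        have hb := hf0 (x - z)
        rw [← mul_sub, abs_mul]
        rcases le_total |g x| M with h | h
        · have := mul_le_mul_of_nonneg_right h (abs_nonneg (f (x - y) - f (x - z)))
          have : 0 ≤ M⁻¹ * (g x ^ 2 * f (x - y) + g x ^ 2 * f (x - z)) := by positivity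
          linarith
        · have h1 : |f (x - y) - f (x - z)| ≤ f (x - y) + f (x - z) := by
            rw [abs_le]; constructor <;> linarith
          have h2 : |g x| ≤ M⁻¹ * g x ^ 2 := by
            rw [← sq_abs, inv_mul_eq_div, le_div_iff₀ hM]; nlinarith [abs_nonneg (g x)]
          have h3 := mul_le_mul h2 h1 (abs_nonneg _) (by positivity)
          have : 0 ≤ M * |f (x - y) - f (x - z)| := by positivity
          linarith
    _ = M * (∫ x, |f (x + (z - y)) - f x|)
          + M⁻¹ * ((∫ x, g x ^ 2 * f (x - y)) + ∫ x, g x ^ 2 * f (x - z)) := by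
        rw [integral_add (habs.const_mul M) (isum.const_mul _), integral_const_mul,
          integral_const_mul, hshift, integral_add iy iz]
    _ ≤ _ := by
        rw [inv_mul_eq_div]
        gcongr
        linarith

/-- Conditional means of functions with conditional second moment at most `B` are uniformly
equicontinuous; no regularity of the functions is needed. -/
lemma condMean_equicontinuous (hfm : Measurable f) (hf0 : ∀ x, 0 ≤ f x) (hfi : Integrable f)
    {B : ℝ} (hB : 0 ≤ B) {e : ℝ} (he : 0 < e) :
    ∃ r > 0, ∀ (g : (Fin d → ℝ) → ℝ) (z y : Fin d → ℝ), Measurable g → ‖z - y‖ ≤ r →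
      condSecondMoment f g z ≤ ENNReal.ofReal B → condSecondMoment f g y ≤ ENNReal.ofReal B →
      |condMean f g y - condMean f g z| ≤ e := by
  -- The truncation level makes the tail term `2 * B / M` at most `e / 2`.
  set M : ℝ := 4 * B / e + 1 with hMdef
  have hM : 0 < M := by positivity
  have h1 : 2 * B / M ≤ e / 2 := by
    rw [div_le_iff₀ hM, hMdef]; field_simp; nlinarith
  obtain ⟨r, hr, hr'⟩ := Metric.tendsto_nhds_nhds.1 (tendsto_integral_abs_sub_translate hfi)
    (e / (2 * M)) (by positivity)
  refine ⟨r / 2, by positivity, fun g z y hg hzy hz hy => ?_⟩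
  have h2 := hr' (x := z - y) (by simpa using hzy.trans_lt (by linarith))
  rw [Real.dist_eq, sub_zero, abs_of_nonneg (integral_nonneg fun x => abs_nonneg _),
    lt_div_iff₀ (by positivity)] at h2
  have := abs_condMean_sub_le hfm hf0 hfi hg hB hM hz hy
  linarith

lemma measurable_condMean (hfm : Measurable f) (hg : Measurable g) :
    Measurable (condMean f g) := by
  have : Measurable (fun p : (Fin d → ℝ) × (Fin d → ℝ) => g p.2 * f (p.2 - p.1)) := by fun_prop
  exact (this.stronglyMeasurable.integral_prod_right').measurable

end CondMean

/-! ### Kernels, their moments, and averages of independent variables -/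

lemma mem_Icc_neg_one_one_iff_norm_le {d : ℕ} {x : Fin d → ℝ} :
    x ∈ Set.Icc (-1 : Fin d → ℝ) 1 ↔ ‖x‖ ≤ 1 := by
  rw [pi_norm_le_iff_of_nonneg zero_le_one, Set.mem_Icc, Pi.le_def, Pi.le_def, ← forall_and]
  simp [abs_le]

namespace IsKernel

variable {d : ℕ} {K : (Fin d → ℝ) → ℝ}

lemma integrable (hK : IsKernel K) : Integrable K := by
  by_contra h
  exact zero_ne_one ((integral_undef h).symm.trans hK.integral_eq_one)

lemma measurable_scaledKernel (hK : IsKernel K) (h : ℝ) : Measurable (scaledKernel K h) := by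
  have := hK.measurable
  unfold scaledKernel
  fun_prop

lemma scaledKernel_nonneg (hK : IsKernel K) {h : ℝ} (hh : 0 < h) (x : Fin d → ℝ) :
    0 ≤ scaledKernel K h x :=
  div_nonneg (hK.nonneg _) (by positivity)

lemma scaledKernel_eq_zero (hK : IsKernel K) {h : ℝ} (hh : 0 < h) {x : Fin d → ℝ}
    (hx : h < ‖x‖) : scaledKernel K h x = 0 := by
  rw [scaledKernel, hK.eq_zero_off_cube, zero_div]
  rw [mem_Icc_neg_one_one_iff_norm_le, norm_smul, norm_inv, Real.norm_of_nonneg hh.le,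
    inv_mul_le_iff₀ hh]
  simpa using hx

lemma integrable_scaledKernel_sub (hK : IsKernel K) {h : ℝ} (hh : 0 < h) (z : Fin d → ℝ) :
    Integrable fun y => scaledKernel K h (z - y) := by
  have h1 : Integrable (scaledKernel K h) :=
    (hK.integrable.comp_smul (inv_ne_zero hh.ne')).div_const _
  exact h1.comp_sub_left z

lemma integral_scaledKernel_sub (hK : IsKernel K) {h : ℝ} (hh : 0 < h) (z : Fin d → ℝ) :
    ∫ y, scaledKernel K h (z - y) = 1 := by
  rw [integral_sub_left_eq_self (scaledKernel K h) volume z]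
  unfold scaledKernel
  rw [integral_div, Measure.integral_comp_inv_smul_of_nonneg _ _ hh.le, hK.integral_eq_one,
    Module.finrank_fin_fun, smul_eq_mul, mul_one, div_self (by positivity)]

lemma integrable_scaledKernel_sub_sq (hK : IsKernel K) {h : ℝ} (hh : 0 < h) (z : Fin d → ℝ) :
    Integrable fun y => scaledKernel K h (z - y) ^ 2 := by
  have h1 : Integrable fun x => scaledKernel K h x ^ 2 := by
    simp_rw [scaledKernel, div_pow]
    exact (hK.sq_integrable.comp_smul (inv_ne_zero hh.ne')).div_const _
  exact h1.comp_sub_left z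

end IsKernel

lemma integral_scaledKernel_sub_sq {d : ℕ} (K : (Fin d → ℝ) → ℝ) {h : ℝ} (hh : 0 < h) (z : Fin d → ℝ) :
    ∫ y, scaledKernel K h (z - y) ^ 2 = (∫ x, K x ^ 2) / h ^ d := by
  rw [integral_sub_left_eq_self (fun x => scaledKernel K h x ^ 2) volume z]
  simp_rw [scaledKernel, div_pow]
  rw [integral_div, Measure.integral_comp_inv_smul_of_nonneg (f := fun x => K x ^ 2) _ hh.le,
    Module.finrank_fin_fun, smul_eq_mul]
  have : h ^ d ≠ 0 := by positivity
  field_simp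

section KernelMoments

variable {Ω : Type*} [MeasurableSpace Ω] {P : Measure Ω} {d : ℕ}
  {Z : Ω → Fin d → ℝ} {fZ : (Fin d → ℝ) → ℝ} {K : (Fin d → ℝ) → ℝ} {h : ℝ} {z : Fin d → ℝ}

lemma lintegral_scaledKernel_sq_le (hZ : Measurable Z) (hfZ : HasLebesgueDensity P Z fZ)
    (hK : IsKernel K) (hh : 0 < h) {F : ℝ} (hF : ∀ y, ‖z - y‖ ≤ h → fZ y ≤ F) :
    ∫⁻ ω, ENNReal.ofReal (scaledKernel K h (z - Z ω) ^ 2) ∂P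
      ≤ ENNReal.ofReal (F * ((∫ x, K x ^ 2) / h ^ d)) := by
  have hm := hK.measurable_scaledKernel h
  have hF0 : 0 ≤ F := (hfZ.2.1 z).trans (hF z (by simpa using hh.le))
  rw [← lintegral_map (f := fun y => ENNReal.ofReal (scaledKernel K h (z - y) ^ 2))
    (by fun_prop) hZ, hfZ.lintegral_map (by fun_prop), ← integral_scaledKernel_sub_sq K hh z,
    ← integral_const_mul, ofReal_integral_eq_lintegral_ofReal
      ((hK.integrable_scaledKernel_sub_sq hh z).const_mul _)
      (Eventually.of_forall fun y => mul_nonneg hF0 (sq_nonneg _))]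
  refine lintegral_mono fun y => ?_
  rw [← ENNReal.ofReal_mul (sq_nonneg _), mul_comm F]
  refine ENNReal.ofReal_le_ofReal ?_
  rcases le_or_gt ‖z - y‖ h with hy | hy
  · exact mul_le_mul_of_nonneg_left (hF y hy) (sq_nonneg _)
  · simp [hK.scaledKernel_eq_zero hh hy]

lemma memLp_scaledKernel (hZ : Measurable Z) (hfZ : HasLebesgueDensity P Z fZ)
    (hK : IsKernel K) (hh : 0 < h) {F : ℝ} (hF : ∀ y, ‖z - y‖ ≤ h → fZ y ≤ F) :
    MemLp (fun ω => scaledKernel K h (z - Z ω)) 2 P := by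
  have hm := hK.measurable_scaledKernel h
  have hmZ : Measurable fun ω => scaledKernel K h (z - Z ω) := by fun_prop
  rw [memLp_two_iff_integrable_sq hmZ.aestronglyMeasurable]
  refine ⟨(hmZ.pow_const 2).aestronglyMeasurable, ?_⟩
  rw [hasFiniteIntegral_iff_ofReal (Eventually.of_forall fun _ => sq_nonneg _)]
  exact (lintegral_scaledKernel_sq_le hZ hfZ hK hh hF).trans_lt ENNReal.ofReal_lt_top

/-- The bias of a kernel density estimator is at most the oscillation of the density at the scale
of the bandwidth. -/
lemma abs_integral_scaledKernel_sub_le (hZ : Measurable Z) (hfZ : HasLebesgueDensity P Z fZ)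
    (hK : IsKernel K) (hh : 0 < h) {e : ℝ}
    (he : ∀ y, ‖z - y‖ ≤ h → |fZ y - fZ z| ≤ e) :
    |∫ ω, scaledKernel K h (z - Z ω) ∂P - fZ z| ≤ e := by
  have hm := hK.measurable_scaledKernel h
  have hfm := hfZ.1
  have hi := hK.integrable_scaledKernel_sub hh z
  have hbound : ∀ y, |scaledKernel K h (z - y) * (fZ y - fZ z)| ≤ scaledKernel K h (z - y) * e := by
    intro y
    rw [abs_mul, abs_of_nonneg (hK.scaledKernel_nonneg hh _)]
    rcases le_or_gt ‖z - y‖ h with hy | hy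
    · exact mul_le_mul_of_nonneg_left (he y hy) (hK.scaledKernel_nonneg hh _)
    · simp [hK.scaledKernel_eq_zero hh hy]
  have hi2 : Integrable fun y => scaledKernel K h (z - y) * (fZ y - fZ z) :=
    (hi.mul_const e).mono' (by fun_prop) (Eventually.of_forall hbound)
  have h1 : ∫ ω, scaledKernel K h (z - Z ω) ∂P - fZ z
      = ∫ y, scaledKernel K h (z - y) * (fZ y - fZ z) := by
    have hmy : Measurable fun y => scaledKernel K h (z - y) := by fun_prop
    rw [← integral_map (φ := Z) (f := fun y => scaledKernel K h (z - y)) hZ.aemeasurable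
      hmy.aestronglyMeasurable, hfZ.integral_map]
    have h2 : ∀ y, scaledKernel K h (z - y) * fZ y
        = scaledKernel K h (z - y) * (fZ y - fZ z) + scaledKernel K h (z - y) * fZ z := by
      intro y; ring
    simp_rw [h2]
    rw [integral_add hi2 (hi.mul_const _), integral_mul_const, hK.integral_scaledKernel_sub hh]
    ring
  rw [h1]
  calc |∫ y, scaledKernel K h (z - y) * (fZ y - fZ z)|
      ≤ ∫ y, |scaledKernel K h (z - y) * (fZ y - fZ z)| := abs_integral_le_integral_abs
    _ ≤ ∫ y, scaledKernel K h (z - y) * e := integral_mono hi2.abs (hi.mul_const e) hbound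
    _ = e := by rw [integral_mul_const, hK.integral_scaledKernel_sub hh, one_mul]

end KernelMoments

section Averages

variable {Ω : Type*} [MeasurableSpace Ω] {P : Measure Ω} [IsProbabilityMeasure P]

/-- The mean squared error of an average of pairwise independent, identically distributed variables
about a constant `c` is at most a variance term plus the squared bias. -/
lemma lintegral_sq_average_sub_le {W : ℕ → Ω → ℝ} {W₀ : Ω → ℝ}
    (hind : Pairwise fun i j => IndepFun (W i) (W j) P) (hid : ∀ i, IdentDistrib (W i) W₀ P P)
    (hW₀ : MemLp W₀ 2 P) {n : ℕ} (hn : n ≠ 0) (c : ℝ) :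
    ∫⁻ ω, ENNReal.ofReal (((∑ i ∈ Finset.range n, W i ω) / n - c) ^ 2) ∂P
      ≤ ENNReal.ofReal ((∫ ω, W₀ ω ^ 2 ∂P) / n + (∫ ω, W₀ ω ∂P - c) ^ 2) := by
  have hW : ∀ i, MemLp (W i) 2 P := fun i => (hid i).symm.memLp_snd hW₀
  have hn' : (n : ℝ) ≠ 0 := by exact_mod_cast hn
  have hS : MemLp (∑ i ∈ Finset.range n, W i) 2 P := memLp_finsetSum' _ fun i _ => hW i
  set A : Ω → ℝ := fun ω => (∑ i ∈ Finset.range n, W i ω) / n - c with hA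
  have hAeq : A = fun ω => (n : ℝ)⁻¹ * (∑ i ∈ Finset.range n, W i) ω - c := by
    ext ω; simp [hA, div_eq_inv_mul]
  have hA2 : MemLp A 2 P := by
    rw [hAeq]; exact (hS.const_mul _).sub (memLp_const c)
  have hmean : ∫ ω, A ω ∂P = ∫ ω, W₀ ω ∂P - c := by
    rw [hAeq, integral_sub ((hS.integrable one_le_two).const_mul _) (integrable_const _),
      integral_const_mul]
    simp only [Finset.sum_apply]
    rw [integral_finsetSum _ fun i _ => (hW i).integrable one_le_two]
    simp_rw [(hid _).integral_eq]
    simp [hn']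
  have hvar : Var[A; P] ≤ (∫ ω, W₀ ω ^ 2 ∂P) / n := by
    rw [hAeq, variance_sub_const (hS.const_mul _).aestronglyMeasurable, variance_const_mul,
      IndepFun.variance_sum (fun i _ => hW i) fun i _ j _ hij => hind hij]
    simp_rw [(hid _).variance_eq]
    have := variance_le_expectation_sq (X := W₀) hW₀.aestronglyMeasurable
    rw [Finset.sum_const, Finset.card_range, nsmul_eq_mul]
    calc (n : ℝ)⁻¹ ^ 2 * (n * Var[W₀; P]) = Var[W₀; P] / n := by field_simp
      _ ≤ _ := by gcongr; exact this
  rw [← ofReal_integral_eq_lintegral_ofReal hA2.integrable_sq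
    (Eventually.of_forall fun _ => sq_nonneg _)]
  refine ENNReal.ofReal_le_ofReal ?_
  have := variance_eq_sub hA2
  simp only [Pi.pow_apply, hmean] at this
  linarith

end Averages

/-! ### The weighted noise is centred and square integrable -/

section Noise

variable {Ω : Type*} [MeasurableSpace Ω] {P : Measure Ω}

lemma memLp_two_and_integral_sq_le {f : Ω → ℝ} (hf : AEMeasurable f P) {c : ℝ} (hc : 0 ≤ c)
    (h : ∫⁻ ω, ENNReal.ofReal (f ω ^ 2) ∂P ≤ ENNReal.ofReal c) :
    MemLp f 2 P ∧ ∫ ω, f ω ^ 2 ∂P ≤ c := by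
  constructor
  · rw [memLp_two_iff_integrable_sq hf.aestronglyMeasurable]
    refine ⟨(hf.pow_const 2).aestronglyMeasurable, ?_⟩
    rw [hasFiniteIntegral_iff_ofReal (Eventually.of_forall fun _ => sq_nonneg _)]
    exact h.trans_lt ENNReal.ofReal_lt_top
  · rw [integral_eq_lintegral_of_nonneg_ae (Eventually.of_forall fun _ => sq_nonneg _)
      (hf.pow_const 2).aestronglyMeasurable]
    exact ENNReal.toReal_le_of_le_ofReal hc h

variable {d : ℕ} {Z η : Ω → Fin d → ℝ} {ε : Ω → ℝ}
  {fη : (Fin d → ℝ) → ℝ} {g k : (Fin d → ℝ) → ℝ}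

lemma lintegral_sq_weight {k : (Fin d → ℝ) → ℝ} (hk2 : MemLp (fun ω => k (Z ω)) 2 P) :
    ∫⁻ ω, ENNReal.ofReal (k (Z ω) ^ 2) ∂P = ENNReal.ofReal (∫ ω, k (Z ω) ^ 2 ∂P) :=
  (ofReal_integral_eq_lintegral_ofReal hk2.integrable_sq
    (Eventually.of_forall fun _ => sq_nonneg _)).symm

/-- The conditional second moment given `Z` is bounded by `B` on the support of the weight, so the
weighted signal `k(Z) g(Z + η)` inherits square integrability from `k(Z)`. -/
lemma weight_mul_signal [IsProbabilityMeasure P] (hZ : Measurable Z) (hη : Measurable η)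
    (hind : IndepFun Z η P) (hfη : HasLebesgueDensity P η fη) (hg : Measurable g)
    (hk : Measurable k) (hk2 : MemLp (fun ω => k (Z ω)) 2 P) {B : ℝ} (hB : 0 ≤ B)
    (hgB : ∀ y, k y ≠ 0 → condSecondMoment fη g y ≤ ENNReal.ofReal B) :
    MemLp (fun ω => k (Z ω) * g (Z ω + η ω)) 2 P ∧
      ∫ ω, (k (Z ω) * g (Z ω + η ω)) ^ 2 ∂P ≤ B * ∫ ω, k (Z ω) ^ 2 ∂P := by
  have hm : Measurable fun ω => k (Z ω) * g (Z ω + η ω) := by fun_prop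
  refine memLp_two_and_integral_sq_le hm.aemeasurable
    (mul_nonneg hB (integral_nonneg fun _ => sq_nonneg _)) ?_
  have hF : Measurable fun p : (Fin d → ℝ) × (Fin d → ℝ) =>
      ENNReal.ofReal ((k p.1 * g (p.1 + p.2)) ^ 2) := by fun_prop
  have hmap := hind.map_prod_eq_prod_map_map hZ.aemeasurable hη.aemeasurable
  have : IsProbabilityMeasure (P.map η) := Measure.isProbabilityMeasure_map hη.aemeasurable
  rw [← lintegral_map hF (hZ.prodMk hη), hmap, lintegral_prod _ hF.aemeasurable,
    ENNReal.ofReal_mul hB, ← lintegral_sq_weight hk2,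
    ← lintegral_map (f := fun y => ENNReal.ofReal (k y ^ 2)) (by fun_prop) hZ,
    ← lintegral_const_mul _ (by fun_prop)]
  refine lintegral_mono fun y => ?_
  simp only [mul_pow, ENNReal.ofReal_mul (sq_nonneg (k y))]
  rw [lintegral_const_mul _ (by fun_prop), ← hfη.condSecondMoment_eq hg, mul_comm]
  by_cases hy : k y = 0
  · simp [hy]
  · gcongr
    exact hgB y hy

lemma weight_mul_error (hZ : Measurable Z) (hε : Measurable ε) (hind : IndepFun Z ε P)
    (hεL2 : MemLp ε 2 P) (hk : Measurable k) (hk2 : MemLp (fun ω => k (Z ω)) 2 P) :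
    MemLp (fun ω => k (Z ω) * ε ω) 2 P ∧
      ∫ ω, (k (Z ω) * ε ω) ^ 2 ∂P ≤ (∫ ω, ε ω ^ 2 ∂P) * ∫ ω, k (Z ω) ^ 2 ∂P := by
  have hm : Measurable fun ω => k (Z ω) * ε ω := by fun_prop
  refine memLp_two_and_integral_sq_le hm.aemeasurable
    (mul_nonneg (integral_nonneg fun _ => sq_nonneg _) (integral_nonneg fun _ => sq_nonneg _)) ?_
  have hind2 : IndepFun (fun ω => ENNReal.ofReal (k (Z ω) ^ 2))
      (fun ω => ENNReal.ofReal (ε ω ^ 2)) P :=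
    hind.comp (φ := fun y => ENNReal.ofReal (k y ^ 2)) (ψ := fun t => ENNReal.ofReal (t ^ 2))
      (by fun_prop) (by fun_prop)
  have := lintegral_mul_eq_lintegral_mul_lintegral_of_indepFun (by fun_prop) (by fun_prop) hind2
  simp only [mul_pow, ENNReal.ofReal_mul (sq_nonneg (k _))]
  simp only [Pi.mul_apply] at this
  rw [this, ENNReal.ofReal_mul (integral_nonneg fun _ => sq_nonneg _), ← lintegral_sq_weight hk2,
    mul_comm, ofReal_integral_eq_lintegral_ofReal hεL2.integrable_sq
      (Eventually.of_forall fun _ => sq_nonneg _)]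

lemma weight_mul_condMean [IsProbabilityMeasure P] (hZ : Measurable Z) (hη : Measurable η)
    (hfη : HasLebesgueDensity P η fη) (hg : Measurable g)
    (hk : Measurable k) (hk2 : MemLp (fun ω => k (Z ω)) 2 P) {B : ℝ} (hB : 0 ≤ B)
    (hgB : ∀ y, k y ≠ 0 → condSecondMoment fη g y ≤ ENNReal.ofReal B) :
    MemLp (fun ω => k (Z ω) * condMean fη g (Z ω)) 2 P ∧
      ∫ ω, (k (Z ω) * condMean fη g (Z ω)) ^ 2 ∂P ≤ B * ∫ ω, k (Z ω) ^ 2 ∂P := by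
  have hH := measurable_condMean hfη.1 hg
  have hm : Measurable fun ω => k (Z ω) * condMean fη g (Z ω) := by fun_prop
  refine memLp_two_and_integral_sq_le hm.aemeasurable
    (mul_nonneg hB (integral_nonneg fun _ => sq_nonneg _)) ?_
  rw [ENNReal.ofReal_mul hB, ← lintegral_sq_weight hk2, ← lintegral_const_mul _ (by fun_prop)]
  refine lintegral_mono fun ω => ?_
  rw [← ENNReal.ofReal_mul hB, mul_pow, mul_comm]
  refine ENNReal.ofReal_le_ofReal ?_
  by_cases hy : k (Z ω) = 0
  · simp [hy]
  · exact mul_le_mul_of_nonneg_right (sq_condMean_le hfη.1 hfη.2.1 (hfη.integrable hη)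
      (hfη.integral_eq_one hη) hg hB (hgB _ hy)) (sq_nonneg _)

/-- The tower property for the weighted signal. -/
lemma integral_weight_mul_signal [IsProbabilityMeasure P] (hZ : Measurable Z) (hη : Measurable η)
    (hind : IndepFun Z η P) (hfη : HasLebesgueDensity P η fη) (hg : Measurable g)
    (hk : Measurable k) (hi : Integrable (fun ω => k (Z ω) * g (Z ω + η ω)) P) :
    ∫ ω, k (Z ω) * g (Z ω + η ω) ∂P = ∫ ω, k (Z ω) * condMean fη g (Z ω) ∂P := by
  have hH := measurable_condMean hfη.1 hg
  have hF : Measurable fun p : (Fin d → ℝ) × (Fin d → ℝ) => k p.1 * g (p.1 + p.2) := by fun_prop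
  have hG : Measurable fun y => k y * condMean fη g y := by fun_prop
  have hmap := hind.map_prod_eq_prod_map_map hZ.aemeasurable hη.aemeasurable
  have : IsProbabilityMeasure (P.map η) := Measure.isProbabilityMeasure_map hη.aemeasurable
  have : IsProbabilityMeasure (P.map Z) := Measure.isProbabilityMeasure_map hZ.aemeasurable
  have hi' : Integrable (fun p : (Fin d → ℝ) × (Fin d → ℝ) => k p.1 * g (p.1 + p.2))
      ((P.map Z).prod (P.map η)) := by
    rw [← hmap]
    exact (integrable_map_measure hF.aestronglyMeasurable (hZ.prodMk hη).aemeasurable).2 hi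
  rw [← integral_map (φ := fun ω => (Z ω, η ω))
      (f := fun p : (Fin d → ℝ) × (Fin d → ℝ) => k p.1 * g (p.1 + p.2))
      (hZ.prodMk hη).aemeasurable hF.aestronglyMeasurable, hmap, integral_prod _ hi',
    ← integral_map (f := fun y => k y * condMean fη g y) hZ.aemeasurable hG.aestronglyMeasurable]
  congr 1
  ext y
  dsimp only
  rw [integral_const_mul, ← hfη.condMean_eq]

/-- The weighted noise `k(Z) (Y - E[Y | Z])` is centred and square integrable as soon as `k(Z)` is
and the conditional second moment is bounded on the support of `k`. -/
lemma weight_mul_noise [IsProbabilityMeasure P] (hZ : Measurable Z) (hη : Measurable η)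
    (hε : Measurable ε) (hind : MutuallyIndependent₃ P Z η ε) (hfη : HasLebesgueDensity P η fη) (hg : Measurable g)
    (hεmean : ∫ ω, ε ω ∂P = 0) (hεL2 : MemLp ε 2 P)
    (hk : Measurable k) (hk2 : MemLp (fun ω => k (Z ω)) 2 P) {B : ℝ} (hB : 0 ≤ B)
    (hgB : ∀ y, k y ≠ 0 → condSecondMoment fη g y ≤ ENNReal.ofReal B) :
    MemLp (fun ω => k (Z ω) * (g (Z ω + η ω) + ε ω - condMean fη g (Z ω))) 2 P ∧
    ∫ ω, k (Z ω) * (g (Z ω + η ω) + ε ω - condMean fη g (Z ω)) ∂P = 0 ∧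
    ∫ ω, (k (Z ω) * (g (Z ω + η ω) + ε ω - condMean fη g (Z ω))) ^ 2 ∂P
      ≤ 3 * (2 * B + ∫ ω, ε ω ^ 2 ∂P) * ∫ ω, k (Z ω) ^ 2 ∂P := by
  have hZη : IndepFun Z η P := hind.1.comp measurable_id measurable_fst
  have hZε : IndepFun Z ε P := hind.1.comp measurable_id measurable_snd
  obtain ⟨a1, a2⟩ := weight_mul_signal hZ hη hZη hfη hg hk hk2 hB hgB
  obtain ⟨b1, b2⟩ := weight_mul_error hZ hε hZε hεL2 hk hk2
  obtain ⟨c1, c2⟩ := weight_mul_condMean hZ hη hfη hg hk hk2 hB hgB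
  have e1 : (fun ω => k (Z ω) * (g (Z ω + η ω) + ε ω - condMean fη g (Z ω)))
      = fun ω => k (Z ω) * g (Z ω + η ω) + k (Z ω) * ε ω - k (Z ω) * condMean fη g (Z ω) := by
    ext ω; ring
  have ab : MemLp (fun ω => k (Z ω) * g (Z ω + η ω) + k (Z ω) * ε ω) 2 P := a1.add b1
  have hL2 : MemLp (fun ω => k (Z ω) * (g (Z ω + η ω) + ε ω - condMean fη g (Z ω))) 2 P := by
    rw [e1]; exact ab.sub c1
  refine ⟨hL2, ?_, ?_⟩
  · rw [e1, integral_sub (ab.integrable one_le_two) (c1.integrable one_le_two),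
      integral_add (a1.integrable one_le_two) (b1.integrable one_le_two),
      integral_weight_mul_signal hZ hη hZη hfη hg hk (a1.integrable one_le_two)]
    have hind2 : IndepFun (fun ω => k (Z ω)) ε P := hZε.comp hk measurable_id
    have := hind2.integral_fun_mul_eq_mul_integral (hk.comp hZ).aestronglyMeasurable
      hε.aestronglyMeasurable
    rw [this, hεmean]
    ring
  · have i1 := (a1.integrable_sq.add b1.integrable_sq).add c1.integrable_sq
    calc _ ≤ ∫ ω, 3 * ((k (Z ω) * g (Z ω + η ω)) ^ 2 + (k (Z ω) * ε ω) ^ 2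
          + (k (Z ω) * condMean fη g (Z ω)) ^ 2) ∂P := by
          refine integral_mono hL2.integrable_sq (i1.const_mul 3) fun ω => ?_
          simp only
          set a := k (Z ω) * g (Z ω + η ω) with ha
          set b := k (Z ω) * ε ω with hb
          set c := k (Z ω) * condMean fη g (Z ω) with hc
          have : k (Z ω) * (g (Z ω + η ω) + ε ω - condMean fη g (Z ω)) = a + b - c := by
            rw [ha, hb, hc]; ring
          rw [this]
          nlinarith [sq_nonneg (a - b), sq_nonneg (a + c), sq_nonneg (b + c)]
      _ = 3 * (∫ ω, (k (Z ω) * g (Z ω + η ω)) ^ 2 ∂P + ∫ ω, (k (Z ω) * ε ω) ^ 2 ∂P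
          + ∫ ω, (k (Z ω) * condMean fη g (Z ω)) ^ 2 ∂P) := by
          have i2 : Integrable (fun ω => (k (Z ω) * g (Z ω + η ω)) ^ 2 + (k (Z ω) * ε ω) ^ 2) P :=
            a1.integrable_sq.add b1.integrable_sq
          rw [integral_const_mul, integral_add i2 c1.integrable_sq,
            integral_add a1.integrable_sq b1.integrable_sq]
      _ ≤ _ := by linarith

end Noise

/-! ### A uniform lower bound for the kernel density estimator -/

section Counts

variable {Ω : Type*} [MeasurableSpace Ω] {P : Measure Ω} [IsProbabilityMeasure P]

/-- The Laplace transform of an indicator at `1` is `1 - (1 - e⁻¹) P(A)`, and `1 - e⁻¹ > 5 / 8`. -/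
lemma integral_exp_neg_indicator_le {A : Set Ω} (hA : NullMeasurableSet A P) {q : ℝ}
    (hq : q ≤ P.real A) :
    ∫ ω, Real.exp (-1 * A.indicator (fun _ => (1 : ℝ)) ω) ∂P ≤ Real.exp (-(5 / 8 * q)) := by
  have h1 : ∀ ω, Real.exp (-1 * A.indicator (fun _ => (1 : ℝ)) ω)
      = 1 - A.indicator (fun _ => 1 - Real.exp (-1)) ω := by
    intro ω
    by_cases h : ω ∈ A <;> simp [h]
  have hi : Integrable (A.indicator fun _ => 1 - Real.exp (-1)) P :=
    (integrable_const _).indicator₀ hA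
  simp_rw [h1]
  rw [integral_sub (integrable_const _) hi, integral_indicator₀ hA, setIntegral_const]
  have he := Real.exp_neg_one_lt_d9
  have hp : 0 ≤ P.real A := measureReal_nonneg
  have h2 := Real.add_one_le_exp (-(5 / 8 * q))
  simp only [integral_const, probReal_univ, smul_eq_mul, mul_one]
  nlinarith

/-- A Chernoff bound: in a sample of size `n`, the number of hits of sets of probability at least
`q` is unlikely to be at most half of `n q`. -/
lemma measure_count_le {E : Type*} [MeasurableSpace E] {X : ℕ → Ω → E} (hX : iIndepFun X P)
    (hXm : ∀ i, AEMeasurable (X i) P) {A : Set E} (hA : MeasurableSet A) {q : ℝ}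
    (hq : ∀ i, q ≤ P.real (X i ⁻¹' A)) (n : ℕ) :
    P {ω | ∑ i ∈ Finset.range n, A.indicator (fun _ => (1 : ℝ)) (X i ω) ≤ n * q / 2}
      ≤ ENNReal.ofReal (Real.exp (-(n * q / 8))) := by
  set V : ℕ → Ω → ℝ := fun i ω => A.indicator (fun _ => (1 : ℝ)) (X i ω) with hV
  have hind : Measurable (A.indicator fun _ => (1 : ℝ)) := measurable_const.indicator hA
  have hVm : ∀ i, AEMeasurable (V i) P := fun i => hind.comp_aemeasurable (hXm i)
  have hVi : iIndepFun V P := hX.comp (fun _ => A.indicator fun _ => (1 : ℝ)) fun _ => hind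
  have hSm : AEMeasurable (∑ i ∈ Finset.range n, V i) P :=
    Finset.aemeasurable_sum _ fun i _ => hVm i
  have hint : Integrable (fun ω => Real.exp (-1 * (∑ i ∈ Finset.range n, V i) ω)) P := by
    refine Integrable.of_bound (C := 1) (by fun_prop) (Eventually.of_forall fun ω => ?_)
    rw [Real.norm_of_nonneg (Real.exp_nonneg _), Real.exp_le_one_iff, Finset.sum_apply]
    have : 0 ≤ ∑ i ∈ Finset.range n, V i ω :=
      Finset.sum_nonneg fun i _ => Set.indicator_nonneg (fun _ _ => zero_le_one) _
    linarith
  have hmgf : ∀ i, mgf (V i) P (-1) ≤ Real.exp (-(5 / 8 * q)) := fun i =>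
    integral_exp_neg_indicator_le (A := X i ⁻¹' A) ((hXm i).nullMeasurable hA) (hq i)
  have h1 := measure_le_le_exp_mul_mgf (μ := P) (n * q / 2) (by norm_num : (-1 : ℝ) ≤ 0) hint
  rw [hVi.mgf_sum₀ hVm] at h1
  have h2 : ∏ i ∈ Finset.range n, mgf (V i) P (-1) ≤ Real.exp (-(5 / 8 * q)) ^ n := by
    simpa using Finset.prod_le_prod (s := Finset.range n) (fun i _ => mgf_nonneg)
      (fun i _ => hmgf i)
  rw [← ofReal_measureReal]
  refine ENNReal.ofReal_le_ofReal ?_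
  -- The exponent `5 / 8` exceeds the threshold `1 / 2` by `1 / 8`.
  have h3 : Real.exp (-(n * q / 8))
      = Real.exp (- -1 * (n * q / 2)) * Real.exp (-(5 / 8 * q)) ^ n := by
    rw [← Real.exp_nat_mul, ← Real.exp_add]
    congr 1
    ring
  rw [h3]
  refine le_trans (le_of_eq ?_) (h1.trans (mul_le_mul_of_nonneg_left h2 (Real.exp_nonneg _)))
  simp [hV]

end Counts

section Geometry

variable {d : ℕ}

/-- A kernel that is continuous on the cube is bounded below by some `a > 0` on a ball. It may jump
at the boundary of the cube, but it cannot vanish on the whole interior, as its integral is one. -/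
lemma IsKernel.exists_le_on_closedBall {K : (Fin d → ℝ) → ℝ} (hK : IsKernel K)
    (hcont : ContinuousOn K (Set.Icc (-1) 1)) :
    ∃ (u : Fin d → ℝ) (r a : ℝ), 0 < r ∧ 0 < a ∧ ∀ x, ‖x - u‖ ≤ 2 * r → a ≤ K x := by
  have hpos : ∃ u, ‖u‖ < 1 ∧ 0 < K u := by
    by_contra! hcon
    have h0 : K =ᵐ[volume] 0 := by
      have hs : ∀ᵐ x : Fin d → ℝ, x ∉ Metric.sphere (0 : Fin d → ℝ) 1 :=
        measure_eq_zero_iff_ae_notMem.1 (Measure.addHaar_sphere_of_ne_zero _ _ one_ne_zero)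
      filter_upwards [hs] with x hx
      rcases lt_trichotomy ‖x‖ 1 with h | h | h
      · exact le_antisymm (hcon x h) (hK.nonneg x)
      · exact absurd (by simpa using h) hx
      · exact hK.eq_zero_off_cube x
          (mt mem_Icc_neg_one_one_iff_norm_le.1 (not_le.2 h))
    have := hK.integral_eq_one
    rw [integral_congr_ae h0] at this
    simp at this
  obtain ⟨u, hu, hKu⟩ := hpos
  have hnhds : Set.Icc (-1 : Fin d → ℝ) 1 ∈ 𝓝 u := by
    have : Metric.ball (0 : Fin d → ℝ) 1 ∈ 𝓝 u := Metric.isOpen_ball.mem_nhds (by simpa using hu)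
    filter_upwards [this] with x hx
    exact mem_Icc_neg_one_one_iff_norm_le.2 (by simpa using (mem_ball_zero_iff.1 hx).le)
  have hc := (hcont.continuousAt hnhds).eventually (lt_mem_nhds (half_lt_self hKu))
  obtain ⟨δ, hδ, hb⟩ := Metric.eventually_nhds_iff.1 hc
  refine ⟨u, δ / 4, K u / 2, by positivity, by positivity, fun x hx => (hb ?_).le⟩
  rw [dist_eq_norm]
  linarith

/-- A cube of side `2R` has an `r`-net (in the supremum norm) with at most `(2R/r + 3)^d` points. -/
lemma exists_finset_net (R : ℝ) (hR : 0 ≤ R) {r : ℝ} (hr : 0 < r) :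
    ∃ S : Finset (Fin d → ℝ), (S.card : ℝ) ≤ (2 * R / r + 3) ^ d ∧
      ∀ z : Fin d → ℝ, ‖z‖ ≤ R → ∃ g ∈ S, ‖z - g‖ ≤ r := by
  classical
  set N : ℤ := ⌈R / r⌉ with hN
  have hN0 : 0 ≤ N := Int.ceil_nonneg (by positivity)
  -- The grid points `r • k` with integer coordinates `|k i| ≤ N`; `z` is rounded down.
  refine ⟨(Fintype.piFinset fun _ : Fin d => Finset.Icc (-N) N).image
    (fun k i => r * (k i : ℝ)), ?_, ?_⟩
  · have h1 : ((Fintype.piFinset fun _ : Fin d => Finset.Icc (-N) N).card : ℝ)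
        = (2 * N + 1 : ℝ) ^ d := by
      rw [Fintype.card_piFinset]
      simp only [Int.card_Icc, Finset.prod_const, Finset.card_univ, Fintype.card_fin]
      rw [Nat.cast_pow]
      congr 1
      have : ((N + 1 - -N).toNat : ℤ) = 2 * N + 1 := by
        rw [Int.toNat_of_nonneg (by linarith)]; ring
      exact_mod_cast this
    have h2 : (N : ℝ) ≤ R / r + 1 := (Int.ceil_lt_add_one _).le
    have h3 : (0 : ℝ) ≤ N := by exact_mod_cast hN0
    calc _ ≤ ((Fintype.piFinset fun _ : Fin d => Finset.Icc (-N) N).card : ℝ) := by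
          exact_mod_cast Finset.card_image_le
      _ = (2 * N + 1 : ℝ) ^ d := h1
      _ ≤ _ := by
          refine pow_le_pow_left₀ (by positivity) ?_ d
          rw [mul_div_assoc]
          linarith
  · intro z hz
    refine ⟨fun i => r * (⌊z i / r⌋ : ℝ), Finset.mem_image.2
      ⟨fun i => ⌊z i / r⌋, Fintype.mem_piFinset.2 fun i => Finset.mem_Icc.2 ⟨?_, ?_⟩, rfl⟩, ?_⟩
    · have h1 := abs_le.1 ((Real.norm_eq_abs _) ▸ (norm_le_pi_norm z i).trans hz)
      rw [Int.le_floor]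
      have h2 : R / r ≤ N := Int.le_ceil _
      have h3 : -(R / r) ≤ z i / r := by
        rw [← neg_div]; exact div_le_div_of_nonneg_right h1.1 hr.le
      push_cast
      linarith
    · have h1 := abs_le.1 ((Real.norm_eq_abs _) ▸ (norm_le_pi_norm z i).trans hz)
      have h2 : R / r ≤ N := Int.le_ceil _
      have h3 : z i / r ≤ R / r := div_le_div_of_nonneg_right h1.2 hr.le
      have h4 : ((⌊z i / r⌋ : ℤ) : ℝ) ≤ N := (Int.floor_le _).trans (h3.trans h2)
      exact_mod_cast h4
    · rw [pi_norm_le_iff_of_nonneg hr.le]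
      intro i
      have h1 := Int.floor_le (z i / r)
      have h2 := Int.lt_floor_add_one (z i / r)
      rw [le_div_iff₀ hr] at h1
      rw [div_lt_iff₀ hr] at h2
      rw [Pi.sub_apply, Real.norm_eq_abs, abs_le]
      constructor <;> nlinarith

end Geometry

section LowerBound

variable {Ω : Type*} [MeasurableSpace Ω] {P : Measure Ω} [IsProbabilityMeasure P] {d : ℕ}

lemma HasLebesgueDensity.le_measureReal_preimage_closedBall {Z : Ω → Fin d → ℝ}
    {fZ : (Fin d → ℝ) → ℝ} (hZ : Measurable Z)
    (hfZ : HasLebesgueDensity P Z fZ) {x : Fin d → ℝ} {r c : ℝ} (hr : 0 ≤ r) (hc : 0 ≤ c)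
    (h : ∀ y, ‖y - x‖ ≤ r → c ≤ fZ y) :
    c * (2 * r) ^ d ≤ P.real (Z ⁻¹' Metric.closedBall x r) := by
  have hA : MeasurableSet (Metric.closedBall x r) := measurableSet_closedBall
  have h1 : ENNReal.ofReal (c * (2 * r) ^ d) ≤ P (Z ⁻¹' Metric.closedBall x r) := by
    rw [← Measure.map_apply hZ hA, hfZ.2.2, withDensity_apply _ hA]
    calc ENNReal.ofReal (c * (2 * r) ^ d)
        = ∫⁻ _ in Metric.closedBall x r, ENNReal.ofReal c := by
          rw [setLIntegral_const, Real.volume_pi_closedBall _ hr, Fintype.card_fin,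
            ENNReal.ofReal_mul hc]
      _ ≤ _ := by
          refine setLIntegral_mono' hA fun y hy => ENNReal.ofReal_le_ofReal (h y ?_)
          simpa [dist_eq_norm] using hy
  exact (ENNReal.ofReal_le_iff_le_toReal (measure_ne_top _ _)).1 h1

/-- Uniform lower bound for the kernel density estimator over a bounded set, outside an event of
exponentially small probability: a kernel bounded below by `a` on a ball dominates a multiple of
the number of observations in that ball, and the counts are controlled on a net. -/
lemma measure_not_forall_lt_kernelDensityEstimator_le {Zs : ℕ → Ω → Fin d → ℝ}
    (hXi : iIndepFun Zs P) (hZs : ∀ i, AEMeasurable (Zs i) P)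
    {K : (Fin d → ℝ) → ℝ} (hK : IsKernel K) {u : Fin d → ℝ} {r a : ℝ} (hr : 0 < r) (ha : 0 < a)
    (hKa : ∀ x, ‖x - u‖ ≤ 2 * r → a ≤ K x)
    {I : Set (Fin d → ℝ)} {R : ℝ} (hR : 0 ≤ R) (hIR : ∀ z ∈ I, ‖z‖ ≤ R)
    {w c : ℝ} (hw : 0 < w) (hc : 0 < c)
    (hcZ : ∀ z ∈ I, ∀ x, ‖z - x‖ ≤ w * (r + ‖u‖) →
      ∀ i, c * (2 * (r * w)) ^ d ≤ P.real (Zs i ⁻¹' Metric.closedBall x (r * w)))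
    {n : ℕ} (hn : n ≠ 0) :
    P {ω | ¬ ∀ z ∈ I, a * c * (2 * r) ^ d / 2
        < kernelDensityEstimator K w n (fun i => Zs i ω) z}
      ≤ ENNReal.ofReal ((2 * R / (r * w) + 3) ^ d
          * Real.exp (-(n * (c * (2 * (r * w)) ^ d) / 8))) := by
  classical
  have hrw : 0 < r * w := by positivity
  set q : ℝ := c * (2 * (r * w)) ^ d with hq
  obtain ⟨S, hScard, hS⟩ := exists_finset_net (d := d) R hR hrw
  -- Only net points close to `I` are kept: the density is known to be large near `I` only.
  set S' := S.filter fun g => ∃ z ∈ I, ‖z - g‖ ≤ r * w with hS'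
  set A : (Fin d → ℝ) → Set (Fin d → ℝ) := fun g => Metric.closedBall (g - w • u) (r * w) with hA
  set bad : (Fin d → ℝ) → Set Ω := fun g =>
    {ω | ∑ i ∈ Finset.range n, (A g).indicator (fun _ => (1 : ℝ)) (Zs i ω) ≤ n * q / 2} with hbad
  have hsub : {ω | ¬ ∀ z ∈ I, a * c * (2 * r) ^ d / 2
      < kernelDensityEstimator K w n (fun i => Zs i ω) z} ⊆ ⋃ g ∈ S', bad g := by
    intro ω hω
    simp only [Set.mem_ofPred_eq] at hω
    contrapose! hω
    intro z hz
    obtain ⟨g, hgS, hg⟩ := hS z (hIR z hz)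
    have hgood : n * q / 2 < ∑ i ∈ Finset.range n, (A g).indicator (fun _ => (1 : ℝ)) (Zs i ω) := by
      by_contra! hcon
      exact hω (Set.mem_biUnion (Finset.mem_filter.2 ⟨hgS, z, hz, hg⟩) hcon)
    have hterm : ∀ i, a / w ^ d * (A g).indicator (fun _ => (1 : ℝ)) (Zs i ω)
        ≤ scaledKernel K w (z - Zs i ω) * 1 := by
      intro i
      rw [mul_one]
      by_cases hi : Zs i ω ∈ A g
      · rw [Set.indicator_of_mem hi, mul_one, scaledKernel]
        gcongr
        refine hKa _ ?_
        have h1 : w⁻¹ • (z - Zs i ω) - u = w⁻¹ • ((z - g) + (g - w • u - Zs i ω)) := by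
          rw [show (z - g) + (g - w • u - Zs i ω) = (z - Zs i ω) - w • u by abel,
            smul_sub w⁻¹ (z - Zs i ω), smul_smul, inv_mul_cancel₀ hw.ne', one_smul]
        rw [h1, norm_smul, norm_inv, Real.norm_of_nonneg hw.le, inv_mul_le_iff₀ hw]
        refine (norm_add_le _ _).trans ?_
        have h2 : ‖g - w • u - Zs i ω‖ ≤ r * w := by
          rw [← dist_eq_norm, dist_comm]; exact hi
        linarith
      · rw [Set.indicator_of_notMem hi, mul_zero]
        exact hK.scaledKernel_nonneg hw _
    have hn' : (0 : ℝ) < n := by positivity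
    have hwd : 0 < w ^ d := by positivity
    rw [kernelDensityEstimator, kernelAverage, lt_div_iff₀ hn']
    refine lt_of_lt_of_le ?_ (Finset.sum_le_sum fun i _ => hterm i)
    rw [← Finset.mul_sum]
    refine lt_of_eq_of_lt ?_ (mul_lt_mul_of_pos_left hgood (by positivity))
    rw [hq, show 2 * (r * w) = (2 * r) * w by ring, mul_pow (2 * r) w]
    field_simp
  have hbadP : ∀ g ∈ S', P (bad g) ≤ ENNReal.ofReal (Real.exp (-(n * q / 8))) := by
    intro g hg
    obtain ⟨z, hz, hzg⟩ := (Finset.mem_filter.1 hg).2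
    refine measure_count_le hXi hZs measurableSet_closedBall (fun i => hcZ z hz _ ?_ i) n
    rw [show z - (g - w • u) = (z - g) + w • u by abel]
    refine (norm_add_le _ _).trans ?_
    rw [norm_smul, Real.norm_of_nonneg hw.le]
    linarith
  calc _ ≤ ∑ g ∈ S', P (bad g) := (measure_mono hsub).trans (measure_biUnion_finset_le _ _)
    _ ≤ ∑ _g ∈ S', ENNReal.ofReal (Real.exp (-(n * q / 8))) := Finset.sum_le_sum hbadP
    _ = ENNReal.ofReal (S'.card * Real.exp (-(n * q / 8))) := by
        rw [Finset.sum_const, nsmul_eq_mul, ENNReal.ofReal_mul (by positivity),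
          ENNReal.ofReal_natCast]
    _ ≤ _ := by
        refine ENNReal.ofReal_le_ofReal (mul_le_mul_of_nonneg_right ?_ (Real.exp_nonneg _))
        refine le_trans ?_ hScard
        exact_mod_cast Finset.card_filter_le _ _

end LowerBound

/-! ### Bandwidth asymptotics and mean squared errors -/

section Bandwidths

lemma tendsto_natCast_rpow_one_div_atTop (d : ℕ) :
    Tendsto (fun n : ℕ => (n : ℝ) ^ (1 / ((d : ℝ) + 4))) atTop atTop :=
  (tendsto_rpow_atTop (by positivity)).comp tendsto_natCast_atTop_atTop

lemma natCast_rpow_one_div_pow (d n : ℕ) :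
    ((n : ℝ) ^ (1 / ((d : ℝ) + 4))) ^ (d + 4) = n := by
  rw [← Real.rpow_natCast, ← Real.rpow_mul (Nat.cast_nonneg n)]
  push_cast
  rw [one_div_mul_cancel (by positivity), Real.rpow_one]

variable {d : ℕ} {w : ℕ → ℝ}

lemma tendsto_zero_of_isTheta_log
    (hw : w =Θ[atTop] fun n : ℕ => (Real.log n / n) ^ (1 / ((d : ℝ) + 4))) :
    Tendsto w atTop (𝓝 0) := by
  refine hw.1.trans_tendsto ?_
  have h1 : Tendsto (fun x : ℝ => Real.log x / x) atTop (𝓝 0) := by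
    simpa using Real.isLittleO_log_id_atTop.tendsto_div_nhds_zero
  have h2 := (h1.comp tendsto_natCast_atTop_atTop).rpow_const (p := 1 / ((d : ℝ) + 4))
    (Or.inr (by positivity))
  rw [Real.zero_rpow (by positivity)] at h2
  exact h2

/-- The logarithmic factor only enlarges the bandwidth, and is dropped. -/
lemma exists_le_of_isTheta_log (hwpos : ∀ᶠ n in atTop, 0 < w n)
    (hw : w =Θ[atTop] fun n : ℕ => (Real.log n / n) ^ (1 / ((d : ℝ) + 4))) :
    ∃ c > 0, ∀ᶠ n : ℕ in atTop, c / (n : ℝ) ^ (1 / ((d : ℝ) + 4)) ≤ w n := by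
  obtain ⟨C, hC, hb⟩ := hw.2.exists_pos
  refine ⟨C⁻¹, by positivity, ?_⟩
  have hlog : ∀ᶠ n : ℕ in atTop, 1 ≤ Real.log n :=
    (Real.tendsto_log_atTop.comp tendsto_natCast_atTop_atTop).eventually_ge_atTop 1
  filter_upwards [hb.bound, hwpos, hlog, eventually_gt_atTop 0] with n hn hwn hl hn0
  have hn0' : (0 : ℝ) < n := by exact_mod_cast hn0
  rw [Real.norm_of_nonneg hwn.le, Real.norm_of_nonneg (by positivity),
    Real.div_rpow (by linarith) hn0'.le] at hn
  have h1 : (1 : ℝ) ≤ Real.log n ^ (1 / ((d : ℝ) + 4)) := Real.one_le_rpow hl (by positivity)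
  have h2 : 1 / (n : ℝ) ^ (1 / ((d : ℝ) + 4)) ≤ C * w n :=
    le_trans (div_le_div_of_nonneg_right h1 (by positivity)) hn
  rw [inv_eq_one_div, div_right_comm, div_le_iff₀' hC]
  exact h2

/-- A bandwidth of order at least `n ^ (-1 / (d + 4))` satisfies `n w ^ d ≥ c n ^ (1 / (d + 4))`
and `w ^ (-d) ≤ C n ^ (d / (d + 4))`. -/
lemma bandwidth_bounds {c : ℝ} (hc : 0 < c) {n : ℕ} (hn : n ≠ 0) {v : ℝ}
    (hv : c / (n : ℝ) ^ (1 / ((d : ℝ) + 4)) ≤ v) :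
    c ^ d * (n : ℝ) ^ (1 / ((d : ℝ) + 4)) ≤ n * v ^ d ∧
      (v ^ d)⁻¹ ≤ (c ^ d)⁻¹ * ((n : ℝ) ^ (1 / ((d : ℝ) + 4))) ^ d := by
  have hs := natCast_rpow_one_div_pow d n
  have hn' : (1 : ℝ) ≤ n := by exact_mod_cast Nat.one_le_iff_ne_zero.2 hn
  have hs1 : 1 ≤ (n : ℝ) ^ (1 / ((d : ℝ) + 4)) := Real.one_le_rpow hn' (by positivity)
  set s := (n : ℝ) ^ (1 / ((d : ℝ) + 4)) with hsdef
  have hs0 : 0 < s := by linarith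
  have h1 : c ^ d / s ^ d ≤ v ^ d := by
    rw [← div_pow]; exact pow_le_pow_left₀ (by positivity) hv d
  have h0 : 0 < c ^ d / s ^ d := by positivity
  constructor
  · calc c ^ d * s ≤ c ^ d * s ^ 4 := by
          refine mul_le_mul_of_nonneg_left (le_self_pow₀ hs1 (by norm_num)) (by positivity)
      _ = s ^ (d + 4) * (c ^ d / s ^ d) := by rw [pow_add]; field_simp
      _ ≤ n * v ^ d := by rw [hs]; gcongr
  · calc (v ^ d)⁻¹ ≤ (c ^ d / s ^ d)⁻¹ := by gcongr
      _ = (c ^ d)⁻¹ * s ^ d := by rw [inv_div, div_eq_inv_mul]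

lemma tendsto_natCast_mul_pow_atTop_of_isTheta_log (hwpos : ∀ᶠ n in atTop, 0 < w n)
    (hw : w =Θ[atTop] fun n : ℕ => (Real.log n / n) ^ (1 / ((d : ℝ) + 4))) :
    Tendsto (fun n : ℕ => (n : ℝ) * w n ^ d) atTop atTop := by
  obtain ⟨c, hc, hcw⟩ := exists_le_of_isTheta_log hwpos hw
  refine tendsto_atTop_mono' _ ?_
    ((tendsto_natCast_rpow_one_div_atTop d).const_mul_atTop (pow_pos hc d))
  filter_upwards [hcw, eventually_ne_atTop 0] with n h1 h2 using (bandwidth_bounds hc h2 h1).1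

/-- The cardinality of the net times the failure probability at one net point tends to zero. -/
lemma tendsto_net_mul_exp_of_isTheta_log (hwpos : ∀ᶠ n in atTop, 0 < w n)
    (hw : w =Θ[atTop] fun n : ℕ => (Real.log n / n) ^ (1 / ((d : ℝ) + 4)))
    {R r a : ℝ} (hR : 0 ≤ R) (hr : 0 < r) (ha : 0 < a) :
    Tendsto (fun n : ℕ => (2 * R / (r * w n) + 3) ^ d
      * Real.exp (-(n * (a * (2 * (r * w n)) ^ d) / 8))) atTop (𝓝 0) := by
  obtain ⟨c, hc, hcw⟩ := exists_le_of_isTheta_log hwpos hw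
  set b : ℝ := a * (2 * r) ^ d / 8 * c ^ d with hb
  have hb0 : 0 < b := by positivity
  set C : ℝ := (2 * R / r + 3) ^ d * (c ^ d)⁻¹ with hC
  have hlim := ((tendsto_rpow_mul_exp_neg_mul_atTop_nhds_zero (d : ℝ) b hb0).comp
    (tendsto_natCast_rpow_one_div_atTop d)).const_mul C
  rw [mul_zero] at hlim
  refine squeeze_zero' ?_ ?_ hlim
  · filter_upwards [hwpos] with n hn
    positivity
  · have hw1 := (tendsto_zero_of_isTheta_log hw).eventually_le_const one_pos
    filter_upwards [hcw, eventually_ne_atTop 0, hwpos, hw1] with n h1 h2 h3 h4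
    obtain ⟨k1, k2⟩ := bandwidth_bounds hc h2 h1
    simp only [Function.comp_apply, Real.rpow_natCast]
    set s := (n : ℝ) ^ (1 / ((d : ℝ) + 4)) with hs
    have e1 : (2 * R / (r * w n) + 3) ^ d ≤ C * s ^ d := by
      calc (2 * R / (r * w n) + 3) ^ d ≤ ((2 * R / r + 3) / w n) ^ d := by
            refine pow_le_pow_left₀ (by positivity) ?_ d
            rw [add_div, div_div]
            gcongr
            rw [le_div_iff₀ h3]
            linarith
        _ = (2 * R / r + 3) ^ d * (w n ^ d)⁻¹ := by rw [div_pow, div_eq_mul_inv]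
        _ ≤ (2 * R / r + 3) ^ d * ((c ^ d)⁻¹ * s ^ d) := by gcongr
        _ = _ := by rw [hC, mul_assoc]
    have e2 : Real.exp (-(n * (a * (2 * (r * w n)) ^ d) / 8)) ≤ Real.exp (-b * s) := by
      rw [Real.exp_le_exp, neg_mul, neg_le_neg_iff, ← mul_assoc 2 r, mul_pow (2 * r)]
      have := mul_le_mul_of_nonneg_left k1 (by positivity : 0 ≤ a * (2 * r) ^ d / 8)
      rw [hb]
      linarith
    calc _ ≤ (C * s ^ d) * Real.exp (-b * s) :=
          mul_le_mul e1 e2 (Real.exp_nonneg _) (by positivity)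
      _ = _ := by rw [mul_assoc]

lemma tendsto_natCast_mul_pow_atTop_of_two_mul {h : ℕ → ℝ} (hpos : ∀ᶠ n in atTop, 0 < h n)
    (h0 : Tendsto h atTop (𝓝 0))
    (h2 : Tendsto (fun n : ℕ => (n : ℝ) * h n ^ (2 * d)) atTop atTop) :
    Tendsto (fun n : ℕ => (n : ℝ) * h n ^ d) atTop atTop := by
  refine tendsto_atTop_mono' _ ?_ h2
  filter_upwards [hpos, h0.eventually_le_const one_pos] with n h3 h4
  exact mul_le_mul_of_nonneg_left (pow_le_pow_of_le_one h3.le h4 (by omega)) (Nat.cast_nonneg n)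

end Bandwidths

section SampleErrors

variable {Ω : Type*} [MeasurableSpace Ω] {P : Measure Ω} [IsProbabilityMeasure P] {d : ℕ}

/-- The mean squared error of a kernel density estimator at a point, where `F` bounds the density and
`e` its oscillation at the scale of the bandwidth. -/
lemma lintegral_sq_kernelDensityEstimator_sub_le {Z : Ω → Fin d → ℝ} {fZ : (Fin d → ℝ) → ℝ}
    (hZ : Measurable Z) (hfZ : HasLebesgueDensity P Z fZ) {Zs : ℕ → Ω → Fin d → ℝ}
    (hind : iIndepFun Zs P) (hid : ∀ i, IdentDistrib (Zs i) Z P P)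
    {K : (Fin d → ℝ) → ℝ} (hK : IsKernel K) {h : ℝ} (hh : 0 < h) {z : Fin d → ℝ} {F e : ℝ}
    (hF : ∀ y, ‖z - y‖ ≤ h → fZ y ≤ F) (he : ∀ y, ‖z - y‖ ≤ h → |fZ y - fZ z| ≤ e)
    {n : ℕ} (hn : n ≠ 0) :
    ∫⁻ ω, ENNReal.ofReal ((kernelDensityEstimator K h n (fun i => Zs i ω) z - fZ z) ^ 2) ∂P
      ≤ ENNReal.ofReal (F * (∫ x, K x ^ 2) / (n * h ^ d) + e ^ 2) := by
  have hm := hK.measurable_scaledKernel h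
  have hφ : Measurable fun y => scaledKernel K h (z - y) := by fun_prop
  have hF0 : 0 ≤ F := (hfZ.2.1 z).trans (hF z (by simpa using hh.le))
  have hL2 := memLp_scaledKernel hZ hfZ hK hh hF
  have key := lintegral_sq_average_sub_le (P := P)
    (W := fun i ω => scaledKernel K h (z - Zs i ω)) (W₀ := fun ω => scaledKernel K h (z - Z ω))
    (fun i j hij => (hind.indepFun hij).comp hφ hφ) (fun i => (hid i).comp hφ) hL2 hn (fZ z)
  simp only [kernelDensityEstimator, kernelAverage, mul_one]
  refine key.trans (ENNReal.ofReal_le_ofReal ?_)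
  have hκ : 0 ≤ ∫ x, K x ^ 2 := integral_nonneg fun _ => sq_nonneg _
  have h1 := (memLp_two_and_integral_sq_le hL2.aestronglyMeasurable.aemeasurable
    (by positivity) (lintegral_scaledKernel_sq_le hZ hfZ hK hh hF)).2
  have h2 := abs_integral_scaledKernel_sub_le hZ hfZ hK hh he
  have h3 : (∫ ω, scaledKernel K h (z - Z ω) ∂P - fZ z) ^ 2 ≤ e ^ 2 := by
    rw [← sq_abs]; exact pow_le_pow_left₀ (abs_nonneg _) h2 2
  have h4 : (∫ ω, scaledKernel K h (z - Z ω) ^ 2 ∂P) / n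
      ≤ F * (∫ x, K x ^ 2) / (n * h ^ d) := by
    rw [mul_comm (n : ℝ), ← div_div]
    refine div_le_div_of_nonneg_right ?_ (Nat.cast_nonneg n)
    rwa [mul_div_assoc]
  linarith

/-- The kernel average of the centred noise has mean zero, and variance of order `1 / (n h ^ d)`. -/
lemma lintegral_sq_kernelAverage_noise_le {Z η : Ω → Fin d → ℝ} {ε : Ω → ℝ}
    {fZ fη g : (Fin d → ℝ) → ℝ}
    (hZ : Measurable Z) (hη : Measurable η) (hε : Measurable ε)
    (hmut : MutuallyIndependent₃ P Z η ε)
    (hfZ : HasLebesgueDensity P Z fZ) (hfη : HasLebesgueDensity P η fη) (hg : Measurable g)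
    (hεmean : ∫ ω, ε ω ∂P = 0) (hεL2 : MemLp ε 2 P)
    {Zs : ℕ → Ω → Fin d → ℝ} {Ys : ℕ → Ω → ℝ}
    (hind : iIndepFun (fun i ω => (Zs i ω, Ys i ω)) P)
    (hid : ∀ i, IdentDistrib (fun ω => (Zs i ω, Ys i ω)) (fun ω => (Z ω, g (Z ω + η ω) + ε ω)) P P)
    {K : (Fin d → ℝ) → ℝ} (hK : IsKernel K) {h : ℝ} (hh : 0 < h) {z : Fin d → ℝ} {F B : ℝ}
    (hB : 0 ≤ B) (hF : ∀ y, ‖z - y‖ ≤ h → fZ y ≤ F)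
    (hgB : ∀ y, ‖z - y‖ ≤ h → condSecondMoment fη g y ≤ ENNReal.ofReal B)
    {n : ℕ} (hn : n ≠ 0) :
    ∫⁻ ω, ENNReal.ofReal (kernelAverage K h n (fun i => Zs i ω)
        (fun i => Ys i ω - condMean fη g (Zs i ω)) z ^ 2) ∂P
      ≤ ENNReal.ofReal (3 * (2 * B + ∫ ω, ε ω ^ 2 ∂P) * (F * (∫ x, K x ^ 2)) / (n * h ^ d)) := by
  have hm := hK.measurable_scaledKernel h
  have hH := measurable_condMean hfη.1 hg
  have hk : Measurable fun y => scaledKernel K h (z - y) := by fun_prop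
  have hφ : Measurable fun p : (Fin d → ℝ) × ℝ =>
    scaledKernel K h (z - p.1) * (p.2 - condMean fη g p.1) := by fun_prop
  have hF0 : 0 ≤ F := (hfZ.2.1 z).trans (hF z (by simpa using hh.le))
  have hκ : 0 ≤ ∫ x, K x ^ 2 := integral_nonneg fun _ => sq_nonneg _
  have hL2 := memLp_scaledKernel hZ hfZ hK hh hF
  have h1 := (memLp_two_and_integral_sq_le hL2.aestronglyMeasurable.aemeasurable
    (by positivity) (lintegral_scaledKernel_sq_le hZ hfZ hK hh hF)).2
  obtain ⟨n1, n2, n3⟩ := weight_mul_noise hZ hη hε hmut hfη hg hεmean hεL2 hk hL2 hB (fun y hy => by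
    refine hgB y ?_
    by_contra! hcon
    exact hy (hK.scaledKernel_eq_zero hh hcon))
  have key := lintegral_sq_average_sub_le (P := P)
    (W := fun i ω => scaledKernel K h (z - Zs i ω) * (Ys i ω - condMean fη g (Zs i ω)))
    (W₀ := fun ω => scaledKernel K h (z - Z ω) * (g (Z ω + η ω) + ε ω - condMean fη g (Z ω)))
    (fun i j hij => (hind.indepFun hij).comp hφ hφ) (fun i => (hid i).comp hφ) n1 hn 0
  simp only [sub_zero, n2] at key
  refine key.trans (ENNReal.ofReal_le_ofReal ?_)
  have hσ : 0 ≤ ∫ ω, ε ω ^ 2 ∂P := integral_nonneg fun _ => sq_nonneg _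
  have h4 := n3.trans (mul_le_mul_of_nonneg_left h1 (by positivity))
  rw [mul_comm (n : ℝ), ← div_div]
  simp only [ne_eq, OfNat.ofNat_ne_zero, not_false_eq_true, zero_pow, add_zero]
  refine div_le_div_of_nonneg_right (h4.trans (le_of_eq ?_)) (Nat.cast_nonneg n)
  ring

end SampleErrors

/-! ### Comparison of the criteria with the limiting distance -/

section Deterministic

variable {d : ℕ}

/-- A kernel average of `φ` at the sample points only sees values of `φ` within the bandwidth. -/
lemma IsKernel.abs_kernelAverage_sub_le {K : (Fin d → ℝ) → ℝ} (hK : IsKernel K) {h : ℝ}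
    (hh : 0 < h) (n : ℕ) (Z : ℕ → Fin d → ℝ) {φ : (Fin d → ℝ) → ℝ} {z : Fin d → ℝ} {v e : ℝ}
    (hφ : ∀ y, ‖z - y‖ ≤ h → |φ y - v| ≤ e) :
    |kernelAverage K h n Z (fun i => φ (Z i)) z - kernelDensityEstimator K h n Z z * v|
      ≤ e * kernelDensityEstimator K h n Z z := by
  have h1 : kernelAverage K h n Z (fun i => φ (Z i)) z - kernelDensityEstimator K h n Z z * v
      = (∑ i ∈ Finset.range n, scaledKernel K h (z - Z i) * (φ (Z i) - v)) / n := by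
    simp only [kernelDensityEstimator, kernelAverage, mul_sub, Finset.sum_sub_distrib,
      ← Finset.sum_mul, mul_one]
    ring
  rw [h1, abs_div, Nat.abs_cast, kernelDensityEstimator, kernelAverage, ← mul_div_assoc]
  refine div_le_div_of_nonneg_right ?_ (Nat.cast_nonneg n)
  refine (Finset.abs_sum_le_sum_abs _ _).trans ?_
  rw [Finset.mul_sum]
  refine Finset.sum_le_sum fun i _ => ?_
  rw [abs_mul, abs_of_nonneg (hK.scaledKernel_nonneg hh _), mul_one, mul_comm e]
  rcases le_or_gt ‖z - Z i‖ h with hy | hy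
  · exact mul_le_mul_of_nonneg_left (hφ _ hy) (hK.scaledKernel_nonneg hh _)
  · simp [hK.scaledKernel_eq_zero hh hy]

lemma kernelAverage_add (K : (Fin d → ℝ) → ℝ) (h : ℝ) (n : ℕ) (Z : ℕ → Fin d → ℝ) (a b : ℕ → ℝ)
    (z : Fin d → ℝ) :
    kernelAverage K h n Z (fun i => a i + b i) z
      = kernelAverage K h n Z a z + kernelAverage K h n Z b z := by
  simp only [kernelAverage, mul_add, Finset.sum_add_distrib, add_div]

/-- The error of a ratio `(S + T) / q` as an approximation of `v`, where `T ≈ D v` and both `D` and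
`q` approximate the same density value `p`. -/
lemma sq_ratio_sub_le {S T D q v p c e b F : ℝ} (hc : 0 < c) (hq : c < q)
    (hT : |T - D * v| ≤ e * D) (hv : |v| ≤ b) (hF : p ≤ F) (he : 0 ≤ e) (he1 : e ≤ 1) :
    ((S + T) / q - v) ^ 2
      ≤ 4 * (1 + b) ^ 2 / c ^ 2 * (S ^ 2 + (D - p) ^ 2 + (q - p) ^ 2)
        + 4 * F ^ 2 / c ^ 2 * e ^ 2 := by
  have hq0 : 0 < q := hc.trans hq
  have hb : 0 ≤ b := (abs_nonneg v).trans hv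
  have h1 : ((S + T) / q - v) * q = S + (T - D * v) + (D - p) * v - (q - p) * v := by
    field_simp; ring
  have h2 : |(S + T) / q - v| * c ≤ |S| + (1 + b) * |D - p| + b * |q - p| + e * F := by
    calc |(S + T) / q - v| * c ≤ |(S + T) / q - v| * q :=
          mul_le_mul_of_nonneg_left hq.le (abs_nonneg _)
      _ = |S + (T - D * v) + (D - p) * v - (q - p) * v| := by
          rw [← h1, abs_mul, abs_of_pos hq0]
      _ ≤ |S| + |T - D * v| + |(D - p) * v| + |(q - p) * v| := by
          refine (abs_sub _ _).trans (add_le_add ?_ le_rfl)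
          refine (abs_add_le _ _).trans (add_le_add (abs_add_le _ _) le_rfl)
      _ ≤ |S| + e * (|D - p| + F) + |D - p| * b + |q - p| * b := by
          rw [abs_mul, abs_mul]
          have : D ≤ |D - p| + F := by linarith [le_abs_self (D - p)]
          have := hT.trans (mul_le_mul_of_nonneg_left this he)
          gcongr
      _ ≤ _ := by nlinarith [abs_nonneg (D - p)]
  have h3 : (|(S + T) / q - v| * c) ^ 2
      ≤ 4 * (1 + b) ^ 2 * (S ^ 2 + (D - p) ^ 2 + (q - p) ^ 2) + 4 * F ^ 2 * e ^ 2 := by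
    refine (pow_le_pow_left₀ (by positivity) h2 2).trans ?_
    have k1 : (|S| + (1 + b) * |D - p| + b * |q - p| + e * F) ^ 2
        ≤ 4 * (|S| ^ 2 + ((1 + b) * |D - p|) ^ 2 + (b * |q - p|) ^ 2 + (e * F) ^ 2) := by
      nlinarith [sq_nonneg (|S| - (1 + b) * |D - p|), sq_nonneg (|S| - b * |q - p|),
        sq_nonneg (|S| - e * F), sq_nonneg ((1 + b) * |D - p| - b * |q - p|),
        sq_nonneg ((1 + b) * |D - p| - e * F), sq_nonneg (b * |q - p| - e * F)]
    rw [mul_pow (1 + b), mul_pow b, mul_pow e, sq_abs, sq_abs, sq_abs] at k1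
    have k2 : S ^ 2 ≤ (1 + b) ^ 2 * S ^ 2 :=
      le_mul_of_one_le_left (sq_nonneg _) (one_le_pow₀ (by linarith))
    have k3 : b ^ 2 * (q - p) ^ 2 ≤ (1 + b) ^ 2 * (q - p) ^ 2 := by
      gcongr; linarith
    linarith
  rw [mul_pow, sq_abs, ← le_div_iff₀ (by positivity)] at h3
  refine h3.trans (le_of_eq ?_)
  ring

end Deterministic

section ArgMin

/-- If the integrand defining a minimum distance criterion is within an error `√Q`, uniformly in
the parameter, of `H₀ - H θ`, then the minimizer is `2 √(∫ Q)`-close to the truth in `L²`. -/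
lemma lintegral_sq_sub_le_of_isArgMin {E T : Type*} [MeasurableSpace E] {G : Measure E}
    {Θ : Set T} {H : T → E → ℝ} {g : T → E → ℝ} {θ₀ t : T} (hθ₀ : θ₀ ∈ Θ)
    {Q : E → ℝ} (hQm : Measurable Q)
    (hQ : ∀ θ ∈ Θ, ∀ᵐ z ∂G, (g θ z - (H θ₀ z - H θ z)) ^ 2 ≤ Q z)
    (ht : IsArgMin (fun θ => ∫⁻ z, ENNReal.ofReal (g θ z ^ 2) ∂G) Θ t) :
    ∫⁻ z, ENNReal.ofReal ((H θ₀ z - H t z) ^ 2) ∂G ≤ 4 * ∫⁻ z, ENNReal.ofReal (Q z) ∂G := by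
  have hQm' : Measurable fun z => 2 * ENNReal.ofReal (Q z) := by fun_prop
  have h1 : ∫⁻ z, ENNReal.ofReal (g t z ^ 2) ∂G ≤ ∫⁻ z, ENNReal.ofReal (Q z) ∂G := by
    refine (ht.2 θ₀ hθ₀).trans (lintegral_mono_ae ?_)
    filter_upwards [hQ θ₀ hθ₀] with z hz
    exact ENNReal.ofReal_le_ofReal (by simpa using hz)
  calc ∫⁻ z, ENNReal.ofReal ((H θ₀ z - H t z) ^ 2) ∂G
      ≤ ∫⁻ z, (2 * ENNReal.ofReal (Q z) + 2 * ENNReal.ofReal (g t z ^ 2)) ∂G := by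
        refine lintegral_mono_ae ?_
        filter_upwards [hQ t ht.1] with z hz
        have hQ0 : 0 ≤ Q z := (sq_nonneg _).trans hz
        rw [← ENNReal.ofReal_ofNat, ← ENNReal.ofReal_mul (by norm_num),
          ← ENNReal.ofReal_mul (by norm_num), ← ENNReal.ofReal_add (by positivity) (by positivity)]
        refine ENNReal.ofReal_le_ofReal ?_
        -- With `a = g t z` and `x = H θ₀ z - H t z`, `2 (a - x)² + 2 a² - x² = (2 a - x)²`.
        nlinarith [sq_nonneg (g t z + (g t z - (H θ₀ z - H t z)))]
    _ = 2 * ∫⁻ z, ENNReal.ofReal (Q z) ∂G + 2 * ∫⁻ z, ENNReal.ofReal (g t z ^ 2) ∂G := by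
        rw [lintegral_add_left hQm', lintegral_const_mul _ (by fun_prop),
          lintegral_const_mul' _ _ (by norm_num)]
    _ ≤ 2 * ∫⁻ z, ENNReal.ofReal (Q z) ∂G + 2 * ∫⁻ z, ENNReal.ofReal (Q z) ∂G := by gcongr
    _ = _ := by rw [← two_mul, ← mul_assoc]; norm_num

/-- Compactness turns identifiability into a quantitative separation of the true parameter. -/
lemma exists_separation {E V : Type*} [MeasurableSpace E] {G : Measure E} [IsFiniteMeasure G]
    [NormedAddCommGroup V] {Θ : Set V} (hΘ : IsCompact Θ) {H : V → E → ℝ}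
    (hHm : ∀ θ ∈ Θ, AEStronglyMeasurable (H θ) G) {b : ℝ}
    (hHb : ∀ θ ∈ Θ, ∀ᵐ z ∂G, |H θ z| ≤ b) {θ₀ : V} (hθ₀ : θ₀ ∈ Θ)
    (hcont : ∀ᵐ z ∂G, ContinuousOn (fun θ => H θ z) Θ)
    (hid : ∀ θ ∈ Θ, (∀ᵐ z ∂G, H θ₀ z = H θ z) → θ₀ = θ) {ε : ℝ} (hε : 0 < ε) :
    ∃ κ : ℝ, 0 < κ ∧ ∀ θ ∈ Θ, ε ≤ dist θ θ₀ →
      ENNReal.ofReal κ ≤ ∫⁻ z, ENNReal.ofReal ((H θ₀ z - H θ z) ^ 2) ∂G := by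
  set Φ : V → ℝ := fun θ => ∫ z, (H θ₀ z - H θ z) ^ 2 ∂G with hΦ
  have hm : ∀ θ ∈ Θ, AEStronglyMeasurable (fun z => (H θ₀ z - H θ z) ^ 2) G :=
    fun θ hθ => ((hHm θ₀ hθ₀).sub (hHm θ hθ)).pow 2
  have hb : ∀ θ ∈ Θ, ∀ᵐ z ∂G, ‖(H θ₀ z - H θ z) ^ 2‖ ≤ (2 * b) ^ 2 := by
    intro θ hθ
    filter_upwards [hHb θ hθ, hHb θ₀ hθ₀] with z h1 h2
    rw [Real.norm_of_nonneg (sq_nonneg _), ← sq_abs]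
    refine pow_le_pow_left₀ (abs_nonneg _) ((abs_sub _ _).trans ?_) 2
    linarith
  have hint : ∀ θ ∈ Θ, Integrable (fun z => (H θ₀ z - H θ z) ^ 2) G :=
    fun θ hθ => Integrable.of_bound (hm θ hθ) _ (hb θ hθ)
  have hΦc : ContinuousOn Φ Θ := by
    refine continuousOn_of_dominated (bound := fun _ => (2 * b) ^ 2) hm hb (integrable_const _) ?_
    filter_upwards [hcont] with z hz
    exact (continuousOn_const.sub hz).pow 2
  have hcl : IsClosed {θ : V | ε ≤ dist θ θ₀} :=
    isClosed_le continuous_const (continuous_id.dist continuous_const)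
  have hΘ' : IsCompact (Θ ∩ {θ : V | ε ≤ dist θ θ₀}) := hΘ.inter_right hcl
  rcases (Θ ∩ {θ : V | ε ≤ dist θ θ₀}).eq_empty_or_nonempty with he | hne
  · exact ⟨1, one_pos, fun θ hθ hd => absurd (show θ ∈ Θ ∩ {θ : V | ε ≤ dist θ θ₀} from ⟨hθ, hd⟩)
      (by rw [he]; exact Set.notMem_empty θ)⟩
  obtain ⟨θ₁, hθ₁, hmin⟩ := hΘ'.exists_isMinOn hne (hΦc.mono Set.inter_subset_left)
  have hΦ0 : 0 ≤ Φ θ₁ := integral_nonneg fun _ => sq_nonneg _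
  refine ⟨Φ θ₁, lt_of_le_of_ne hΦ0 fun h0 => ?_, fun θ hθ hd => ?_⟩
  · have h1 := (integral_eq_zero_iff_of_nonneg (fun _ => sq_nonneg _) (hint θ₁ hθ₁.1)).1 h0.symm
    have h2 : θ₀ = θ₁ := hid θ₁ hθ₁.1 (by
      filter_upwards [h1] with z hz
      exact sub_eq_zero.1 (pow_eq_zero_iff two_ne_zero |>.1 hz))
    have h3 : ε ≤ dist θ₁ θ₀ := hθ₁.2
    rw [h2, dist_self] at h3
    linarith
  · rw [← ofReal_integral_eq_lintegral_ofReal (hint θ hθ)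
      (Eventually.of_forall fun _ => sq_nonneg _)]
    exact ENNReal.ofReal_le_ofReal (hmin ⟨hθ, hd⟩)

/-- Consistency from a separation property of a discrepancy `Φ` and a bound of the discrepancy at
the estimator by errors which tend to zero in mean, on events of probability tending to one. -/
lemma tendstoInMeasure_of_separation {Ω V : Type*} [MeasurableSpace Ω] {P : Measure Ω}
    [PseudoMetricSpace V] {Θ : Set V} {θ₀ : V} {Φ : V → ENNReal}
    (hsep : ∀ ε : ℝ, 0 < ε → ∃ κ : ℝ, 0 < κ ∧
      ∀ θ ∈ Θ, ε ≤ dist θ θ₀ → ENNReal.ofReal κ ≤ Φ θ)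
    {t : ℕ → Ω → V} {T : ℕ → Ω → ENNReal} (hT : ∀ n, AEMeasurable (T n) P)
    (hT0 : Tendsto (fun n => ∫⁻ ω, T n ω ∂P) atTop (𝓝 0))
    {good : ℕ → Ω → Prop} (hgood : Tendsto (fun n => P {ω | ¬ good n ω}) atTop (𝓝 0))
    {C : ℝ} (hC : 0 < C)
    (hbound : ∀ e : ℝ, 0 < e → e ≤ 1 → ∀ᶠ n in atTop, ∀ᵐ ω ∂P, good n ω →
      t n ω ∈ Θ ∧ Φ (t n ω) ≤ ENNReal.ofReal C * (T n ω + ENNReal.ofReal (e ^ 2))) :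
    TendstoInMeasure P t atTop (fun _ => θ₀) := by
  rw [tendstoInMeasure_iff_dist]
  intro ε hε
  obtain ⟨κ, hκ, hsepκ⟩ := hsep ε hε
  set τ : ℝ := κ / C / 2 with hτ
  have hτ0 : 0 < τ := by positivity
  obtain ⟨e, he, he1, heτ⟩ : ∃ e : ℝ, 0 < e ∧ e ≤ 1 ∧ e ^ 2 ≤ τ := by
    refine ⟨min 1 τ, lt_min one_pos hτ0, min_le_left _ _, ?_⟩
    have h0 : 0 ≤ min 1 τ := le_min zero_le_one hτ0.le
    calc min 1 τ ^ 2 = min 1 τ * min 1 τ := sq _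
      _ ≤ 1 * τ := mul_le_mul (min_le_left _ _) (min_le_right _ _) h0 zero_le_one
      _ = τ := one_mul _
  have hτ' : ENNReal.ofReal τ ≠ 0 := by simpa using hτ0
  have hlim : Tendsto (fun n => P {ω | ¬ good n ω} + (∫⁻ ω, T n ω ∂P) / ENNReal.ofReal τ)
      atTop (𝓝 0) := by
    have := hgood.add (ENNReal.Tendsto.div_const hT0 (Or.inr hτ'))
    simpa using this
  refine tendsto_of_tendsto_of_tendsto_of_le_of_le' tendsto_const_nhds hlim
    (Eventually.of_forall fun _ => zero_le) ?_
  filter_upwards [hbound e he he1] with n hn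
  have hsub : {ω | ε ≤ dist (t n ω) θ₀} ≤ᵐ[P]
      ({ω | ¬ good n ω} ∪ {ω | ENNReal.ofReal τ ≤ T n ω} : Set Ω) := by
    filter_upwards [hn] with ω hω hd
    by_cases hg : good n ω
    · right
      obtain ⟨h1, h2⟩ := hω hg
      have h3 := (hsepκ _ h1 hd).trans h2
      have hCτ : ENNReal.ofReal κ = ENNReal.ofReal C * (ENNReal.ofReal τ + ENNReal.ofReal τ) := by
        rw [← ENNReal.ofReal_add hτ0.le hτ0.le, ← ENNReal.ofReal_mul hC.le, hτ]
        congr 1; field_simp; norm_num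
      rw [hCτ, ENNReal.mul_le_mul_iff_right (by simpa using hC) ENNReal.ofReal_ne_top] at h3
      have h4 := h3.trans (add_le_add_right (ENNReal.ofReal_le_ofReal heτ) (T n ω))
      exact (ENNReal.add_le_add_iff_right ENNReal.ofReal_ne_top).1 h4
    · exact Or.inl hg
  calc P {ω | ε ≤ dist (t n ω) θ₀}
      ≤ P ({ω | ¬ good n ω} ∪ {ω | ENNReal.ofReal τ ≤ T n ω}) := measure_mono_ae hsub
    _ ≤ P {ω | ¬ good n ω} + P {ω | ENNReal.ofReal τ ≤ T n ω} := measure_union_le _ _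
    _ ≤ _ := by
        gcongr
        exact meas_ge_le_lintegral_div (hT n) hτ' ENNReal.ofReal_ne_top

end ArgMin

/-! ### Integrated errors and good events -/

/-- The sum of the squared errors at `z` of the three kernel averages on which both criteria depend:
the noise average `n⁻¹ ∑ᵢ K_h(z - Zᵢ) (Yᵢ - H(Zᵢ))`, which estimates `0`, and the two density
estimators (with the pairs `(K, h)` and `(Kstar, w)`), which estimate `f`. -/
noncomputable def kernelErrors {d : ℕ} (K Kstar : (Fin d → ℝ) → ℝ) (h w : ℝ) (n : ℕ)
    (Z : ℕ → Fin d → ℝ) (Y : ℕ → ℝ) (H f : (Fin d → ℝ) → ℝ) (z : Fin d → ℝ) : ℝ :=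
  kernelAverage K h n Z (fun i => Y i - H (Z i)) z ^ 2
    + (kernelDensityEstimator K h n Z z - f z) ^ 2
    + (kernelDensityEstimator Kstar w n Z z - f z) ^ 2

section Errors

variable {d : ℕ}

lemma aemeasurable_kernelAverage {Ω : Type*} [MeasurableSpace Ω] {P : Measure Ω}
    (G : Measure (Fin d → ℝ)) [SFinite P] [SFinite G]
    {K : (Fin d → ℝ) → ℝ} (hK : IsKernel K) (h : ℝ) (n : ℕ)
    {Zs : ℕ → Ω → Fin d → ℝ} (hZs : ∀ i, AEMeasurable (Zs i) P)
    {a : ℕ → Ω → ℝ} (ha : ∀ i, AEMeasurable (a i) P) :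
    AEMeasurable (fun p : Ω × (Fin d → ℝ) =>
      kernelAverage K h n (fun i => Zs i p.1) (fun i => a i p.1) p.2) (P.prod G) := by
  have hm := hK.measurable_scaledKernel h
  unfold kernelAverage
  refine AEMeasurable.div_const (Finset.aemeasurable_fun_sum _ fun i _ => ?_) _
  exact (hm.comp_aemeasurable (measurable_snd.aemeasurable.sub (hZs i).comp_fst)).mul
    (ha i).comp_fst

lemma aemeasurable_kernelErrors {Ω : Type*} [MeasurableSpace Ω] {P : Measure Ω}
    (G : Measure (Fin d → ℝ)) [SFinite P] [SFinite G]
    {K Kstar : (Fin d → ℝ) → ℝ} (hK : IsKernel K) (hKstar : IsKernel Kstar) (h w : ℝ) (n : ℕ)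
    {Zs : ℕ → Ω → Fin d → ℝ} (hZs : ∀ i, AEMeasurable (Zs i) P)
    {Ys : ℕ → Ω → ℝ} (hYs : ∀ i, AEMeasurable (Ys i) P)
    {H f : (Fin d → ℝ) → ℝ} (hH : Measurable H) (hf : Measurable f) :
    AEMeasurable (fun p : Ω × (Fin d → ℝ) =>
      kernelErrors K Kstar h w n (fun i => Zs i p.1) (fun i => Ys i p.1) H f p.2)
      (P.prod G) := by
  have h1 := aemeasurable_kernelAverage (P := P) G hK h n hZs
    (fun i => (hYs i).sub (hH.comp_aemeasurable (hZs i)))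
  have h2 := aemeasurable_kernelAverage (P := P) G hK h n hZs
    (fun _ => aemeasurable_const (b := (1 : ℝ)))
  have h3 := aemeasurable_kernelAverage (P := P) G hKstar w n hZs
    (fun _ => aemeasurable_const (b := (1 : ℝ)))
  have h4 : AEMeasurable (fun p : Ω × (Fin d → ℝ) => f p.2) (P.prod G) :=
    (hf.comp measurable_snd).aemeasurable
  exact ((h1.pow_const 2).add ((h2.sub h4).pow_const 2)).add ((h3.sub h4).pow_const 2)

lemma IsKernel.measurable_kernelAverage {K : (Fin d → ℝ) → ℝ} (hK : IsKernel K) (h : ℝ) (n : ℕ)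
    (Z : ℕ → Fin d → ℝ) (a : ℕ → ℝ) : Measurable (kernelAverage K h n Z a) := by
  have hm := hK.measurable_scaledKernel h
  unfold kernelAverage
  fun_prop

lemma measurable_kernelErrors {K Kstar : (Fin d → ℝ) → ℝ} (hK : IsKernel K)
    (hKstar : IsKernel Kstar) (h w : ℝ) (n : ℕ) (Z : ℕ → Fin d → ℝ) (Y : ℕ → ℝ)
    (H : (Fin d → ℝ) → ℝ) {f : (Fin d → ℝ) → ℝ} (hf : Measurable f) :
    Measurable (kernelErrors K Kstar h w n Z Y H f) := by
  have h1 := hK.measurable_kernelAverage h n Z (fun i => Y i - H (Z i))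
  have h2 : Measurable (kernelDensityEstimator K h n Z) :=
    hK.measurable_kernelAverage h n Z fun _ => 1
  have h3 : Measurable (kernelDensityEstimator Kstar w n Z) :=
    hKstar.measurable_kernelAverage w n Z fun _ => 1
  unfold kernelErrors
  fun_prop

lemma kernelErrors_nonneg (K Kstar : (Fin d → ℝ) → ℝ) (h w : ℝ) (n : ℕ) (Z : ℕ → Fin d → ℝ)
    (Y : ℕ → ℝ) (H f : (Fin d → ℝ) → ℝ) (z : Fin d → ℝ) :
    0 ≤ kernelErrors K Kstar h w n Z Y H f z := by
  unfold kernelErrors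
  positivity

variable {Ω : Type*} [MeasurableSpace Ω] {P : Measure Ω} [IsProbabilityMeasure P]

/-- The integrated mean squared kernel errors tend to zero: the variances are of order
`1 / (n hᵈ)` and `1 / (n wᵈ)`, and the bias is controlled by the oscillation of the density. -/
lemma tendsto_lintegral_kernelErrors {Z η : Ω → Fin d → ℝ} {ε : Ω → ℝ} {fZ fη g : (Fin d → ℝ) → ℝ}
    (hZ : Measurable Z) (hη : Measurable η) (hε : Measurable ε)
    (hmut : MutuallyIndependent₃ P Z η ε)
    (hfZ : HasLebesgueDensity P Z fZ) (hfη : HasLebesgueDensity P η fη) (hg : Measurable g)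
    (hεmean : ∫ ω, ε ω ∂P = 0) (hεL2 : MemLp ε 2 P)
    {Zs : ℕ → Ω → Fin d → ℝ} {Ys : ℕ → Ω → ℝ}
    (hind : iIndepFun (fun i ω => (Zs i ω, Ys i ω)) P)
    (hid : ∀ i, IdentDistrib (fun ω => (Zs i ω, Ys i ω)) (fun ω => (Z ω, g (Z ω + η ω) + ε ω)) P P)
    {K Kstar : (Fin d → ℝ) → ℝ} (hK : IsKernel K) (hKstar : IsKernel Kstar)
    {h w : ℕ → ℝ} (hhpos : ∀ᶠ n in atTop, 0 < h n) (hwpos : ∀ᶠ n in atTop, 0 < w n)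
    (hh0 : Tendsto h atTop (𝓝 0)) (hw0 : Tendsto w atTop (𝓝 0))
    (hh : Tendsto (fun n : ℕ => (n : ℝ) * h n ^ d) atTop atTop)
    (hw : Tendsto (fun n : ℕ => (n : ℝ) * w n ^ d) atTop atTop)
    {I : Set (Fin d → ℝ)} {G : Measure (Fin d → ℝ)} [IsFiniteMeasure G] (hG : ∀ᵐ z ∂G, z ∈ I)
    {F B ρ : ℝ} (hB : 0 ≤ B) (hρ : 0 < ρ)
    (hF : ∀ z ∈ I, ∀ y, ‖z - y‖ ≤ ρ → fZ y ≤ F)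
    (hgB : ∀ z ∈ I, ∀ y, ‖z - y‖ ≤ ρ → condSecondMoment fη g y ≤ ENNReal.ofReal B)
    (hosc : ∀ e > 0, ∃ r > 0, ∀ z ∈ I, ∀ y, ‖z - y‖ ≤ r → |fZ y - fZ z| ≤ e) :
    Tendsto (fun n => ∫⁻ ω, ∫⁻ z, ENNReal.ofReal (kernelErrors K Kstar (h n) (w n) n
      (fun i => Zs i ω) (fun i => Ys i ω) (condMean fη g) fZ z) ∂G ∂P) atTop (𝓝 0) := by
  have hZs : ∀ i, AEMeasurable (Zs i) P := fun i => (hid i).aemeasurable_fst.fst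
  have hYs : ∀ i, AEMeasurable (Ys i) P := fun i => (hid i).aemeasurable_fst.snd
  have hindZ : iIndepFun Zs P :=
    hind.comp (fun _ p => p.1) fun _ => measurable_fst
  have hidZ : ∀ i, IdentDistrib (Zs i) Z P P := fun i => (hid i).comp measurable_fst
  have hH := measurable_condMean hfη.1 hg
  rw [ENNReal.tendsto_nhds_zero]
  intro δ hδ
  obtain ⟨e, he, heδ⟩ : ∃ e : ℝ, 0 < e ∧ ENNReal.ofReal (3 * e ^ 2) * G Set.univ ≤ δ := by
    have h1 : Tendsto (fun e : ℝ => ENNReal.ofReal (3 * e ^ 2) * G Set.univ) (𝓝[>] 0)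
        (𝓝 (ENNReal.ofReal (3 * 0 ^ 2) * G Set.univ)) := by
      refine Tendsto.mono_left ?_ nhdsWithin_le_nhds
      refine ENNReal.Tendsto.mul_const (ENNReal.tendsto_ofReal ?_) (Or.inr (measure_ne_top _ _))
      exact ((continuous_id.pow 2).const_mul 3).tendsto 0
    simp only [ne_eq, OfNat.ofNat_ne_zero, not_false_eq_true, zero_pow, mul_zero,
      ENNReal.ofReal_zero, zero_mul] at h1
    obtain ⟨e, h2, h3⟩ := ((h1.eventually_le_const hδ).and self_mem_nhdsWithin).exists
    exact ⟨e, h3, h2⟩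
  obtain ⟨r, hr, hosc_e⟩ := hosc e he
  set κ : ℝ := ∫ x, K x ^ 2 with hκ
  set κs : ℝ := ∫ x, Kstar x ^ 2 with hκs
  set A : ℝ := 3 * (2 * B + ∫ ω, ε ω ^ 2 ∂P) * (F * κ) with hA
  -- The limit of the bounds is `2 e²`; for large `n` they are below `3 e²`.
  have hrate : Tendsto (fun n : ℕ => A / (n * h n ^ d) + (F * κ / (n * h n ^ d) + e ^ 2)
      + (F * κs / (n * w n ^ d) + e ^ 2)) atTop (𝓝 (0 + (0 + e ^ 2) + (0 + e ^ 2))) :=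
    ((hh.const_div_atTop _).add ((hh.const_div_atTop _).add_const _)).add
      ((hw.const_div_atTop _).add_const _)
  have hsmall := hrate.eventually_le_const
    (show 0 + (0 + e ^ 2) + (0 + e ^ 2) < 3 * e ^ 2 by nlinarith [pow_pos he 2])
  filter_upwards [hsmall, hhpos, hwpos, hh0.eventually_le_const hr, hw0.eventually_le_const hr,
    hh0.eventually_le_const hρ, hw0.eventually_le_const hρ, eventually_ne_atTop 0]
    with n hn hh1 hw1 hhr hwr hhρ hwρ hn0
  have hmeas := (aemeasurable_kernelErrors (P := P) G hK hKstar (h n) (w n) n hZs hYs hH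
    hfZ.1).ennreal_ofReal
  rw [lintegral_lintegral_swap hmeas]
  refine le_trans ?_ heδ
  rw [← lintegral_const]
  refine lintegral_mono_ae ?_
  filter_upwards [hG] with z hz
  have hFz : 0 ≤ F := (hfZ.2.1 z).trans (hF z hz z (by simpa using hρ.le))
  have b1 := lintegral_sq_kernelAverage_noise_le hZ hη hε hmut hfZ hfη hg hεmean hεL2 hind hid
    hK hh1 hB (fun y hy => hF z hz y (hy.trans hhρ)) (fun y hy => hgB z hz y (hy.trans hhρ)) hn0
  have b2 := lintegral_sq_kernelDensityEstimator_sub_le hZ hfZ hindZ hidZ hK hh1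
    (fun y hy => hF z hz y (hy.trans hhρ)) (fun y hy => hosc_e z hz y (hy.trans hhr)) hn0
  have b3 := lintegral_sq_kernelDensityEstimator_sub_le hZ hfZ hindZ hidZ hKstar hw1
    (fun y hy => hF z hz y (hy.trans hwρ)) (fun y hy => hosc_e z hz y (hy.trans hwr)) hn0
  have hσ : 0 ≤ ∫ ω, ε ω ^ 2 ∂P := integral_nonneg fun _ => sq_nonneg _
  have hκ0 : 0 ≤ κ := integral_nonneg fun _ => sq_nonneg _
  have hκs0 : 0 ≤ κs := integral_nonneg fun _ => sq_nonneg _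
  have hmk : ∀ {K' : (Fin d → ℝ) → ℝ}, IsKernel K' → ∀ (v : ℝ) {a : ℕ → Ω → ℝ},
      (∀ i, AEMeasurable (a i) P) → AEMeasurable
        (fun ω => kernelAverage K' v n (fun i => Zs i ω) (fun i => a i ω) z) P := by
    intro K' hK' v a ha
    have hm := hK'.measurable_scaledKernel v
    unfold kernelAverage
    exact AEMeasurable.div_const (Finset.aemeasurable_fun_sum _ fun i _ =>
      (hm.comp_aemeasurable ((hZs i).const_sub z)).mul (ha i)) _
  have m1 : AEMeasurable (fun ω => ENNReal.ofReal (kernelAverage K (h n) n (fun i => Zs i ω)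
      (fun i => Ys i ω - condMean fη g (Zs i ω)) z ^ 2)) P :=
    ((hmk hK (h n) (fun i => (hYs i).sub (hH.comp_aemeasurable (hZs i)))).pow_const 2).ennreal_ofReal
  have m2 : AEMeasurable (fun ω => ENNReal.ofReal
      ((kernelDensityEstimator K (h n) n (fun i => Zs i ω) z - fZ z) ^ 2)) P :=
    (((hmk hK (h n) (fun _ => aemeasurable_const (b := (1 : ℝ)))).sub_const
      (fZ z)).pow_const 2).ennreal_ofReal
  have m12 : AEMeasurable (fun ω => ENNReal.ofReal (kernelAverage K (h n) n (fun i => Zs i ω)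
      (fun i => Ys i ω - condMean fη g (Zs i ω)) z ^ 2) + ENNReal.ofReal
      ((kernelDensityEstimator K (h n) n (fun i => Zs i ω) z - fZ z) ^ 2)) P := m1.add m2
  have hsplit : ∀ ω, ENNReal.ofReal (kernelErrors K Kstar (h n) (w n) n
      (fun i => Zs i ω) (fun i => Ys i ω) (condMean fη g) fZ z)
      = ENNReal.ofReal (kernelAverage K (h n) n (fun i => Zs i ω)
          (fun i => Ys i ω - condMean fη g (Zs i ω)) z ^ 2)
        + ENNReal.ofReal ((kernelDensityEstimator K (h n) n (fun i => Zs i ω) z - fZ z) ^ 2)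
        + ENNReal.ofReal ((kernelDensityEstimator Kstar (w n) n (fun i => Zs i ω) z
            - fZ z) ^ 2) := by
    intro ω
    rw [kernelErrors, ENNReal.ofReal_add (by positivity) (by positivity),
      ENNReal.ofReal_add (by positivity) (by positivity)]
  simp_rw [hsplit]
  rw [lintegral_add_left' m12, lintegral_add_left' m1]
  calc _ ≤ ENNReal.ofReal (A / (n * h n ^ d)) + ENNReal.ofReal (F * κ / (n * h n ^ d) + e ^ 2)
        + ENNReal.ofReal (F * κs / (n * w n ^ d) + e ^ 2) := add_le_add (add_le_add b1 b2) b3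
    _ = ENNReal.ofReal (A / (n * h n ^ d) + (F * κ / (n * h n ^ d) + e ^ 2)
        + (F * κs / (n * w n ^ d) + e ^ 2)) := by
        rw [← ENNReal.ofReal_add (by positivity) (by positivity),
          ← ENNReal.ofReal_add (by positivity) (by positivity)]
    _ ≤ _ := ENNReal.ofReal_le_ofReal hn

end Errors

section GoodEvents

variable {d : ℕ} {Ω : Type*} [MeasurableSpace Ω] {P : Measure Ω} [IsProbabilityMeasure P]

/-- The kernel density estimator is bounded away from zero on `I`, uniformly, with probability
tending to one. -/
lemma exists_tendsto_measure_not_lt_kernelDensityEstimator {Z : Ω → Fin d → ℝ}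
    {fZ : (Fin d → ℝ) → ℝ} (hZ : Measurable Z) (hfZ : HasLebesgueDensity P Z fZ)
    {Zs : ℕ → Ω → Fin d → ℝ} (hind : iIndepFun Zs P) (hid : ∀ i, IdentDistrib (Zs i) Z P P)
    {K : (Fin d → ℝ) → ℝ} (hK : IsKernel K) (hKc : ContinuousOn K (Set.Icc (-1) 1))
    {w : ℕ → ℝ} (hwpos : ∀ᶠ n in atTop, 0 < w n)
    (hw : w =Θ[atTop] fun n : ℕ => (Real.log n / n) ^ (1 / ((d : ℝ) + 4)))
    {I : Set (Fin d → ℝ)} (hI : Bornology.IsBounded I) {c ρ : ℝ} (hc : 0 < c) (hρ : 0 < ρ)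
    (hcZ : ∀ z ∈ I, ∀ y, ‖z - y‖ ≤ ρ → c ≤ fZ y) :
    ∃ c₀ > 0, Tendsto (fun n => P {ω | ¬ ∀ z ∈ I,
      c₀ < kernelDensityEstimator K (w n) n (fun i => Zs i ω) z}) atTop (𝓝 0) := by
  obtain ⟨u, r, a, hr, ha, hKa⟩ := hK.exists_le_on_closedBall hKc
  obtain ⟨R, hR, hIR⟩ := hI.exists_pos_norm_le
  refine ⟨a * c * (2 * r) ^ d / 2, by positivity, ?_⟩
  have hlim := ENNReal.tendsto_ofReal (tendsto_net_mul_exp_of_isTheta_log hwpos hw hR.le hr hc)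
  rw [ENNReal.ofReal_zero] at hlim
  refine tendsto_of_tendsto_of_tendsto_of_le_of_le' tendsto_const_nhds hlim
    (Eventually.of_forall fun _ => zero_le) ?_
  have hwρ : ∀ᶠ n in atTop, w n * (2 * r + ‖u‖) ≤ ρ := by
    have h1 := (tendsto_zero_of_isTheta_log hw).mul_const (2 * r + ‖u‖)
    rw [zero_mul] at h1
    exact h1.eventually_le_const hρ
  filter_upwards [hwpos, hwρ, eventually_ne_atTop 0] with n hn hnρ hn0
  refine measure_not_forall_lt_kernelDensityEstimator_le hind
    (fun i => (hid i).aemeasurable_fst) hK hr ha hKa hR.le hIR hn hc (fun z hz x hx i => ?_) hn0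
  have hA : MeasurableSet (Metric.closedBall x (r * w n)) := measurableSet_closedBall
  have heq : P.real (Zs i ⁻¹' Metric.closedBall x (r * w n))
      = P.real (Z ⁻¹' Metric.closedBall x (r * w n)) := by
    rw [measureReal_def, measureReal_def, (hid i).measure_mem_eq hA]
  rw [heq]
  refine hfZ.le_measureReal_preimage_closedBall hZ (by positivity) hc.le fun y hy => ?_
  refine hcZ z hz y ?_
  calc ‖z - y‖ = ‖(z - x) - (y - x)‖ := by congr 1; abel
    _ ≤ w n * (r + ‖u‖) + r * w n := (norm_sub_le _ _).trans (add_le_add hx hy)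
    _ ≤ ρ := by linarith

end GoodEvents

/-! ### Consistency -/

lemma IsCompact.exists_pos_forall_norm_sub_le_mem {V : Type*} [NormedAddCommGroup V] {I U : Set V}
    (hI : IsCompact I) (hU : IsOpen U) (hIU : I ⊆ U) :
    ∃ ρ > 0, ∀ z ∈ I, ∀ y, ‖z - y‖ ≤ ρ → y ∈ U := by
  obtain ⟨ρ, hρ, h⟩ := hI.exists_cthickening_subset_open hU hIU
  refine ⟨ρ, hρ, fun z hz y hy => h (Metric.closedBall_subset_cthickening hz ρ ?_)⟩
  rwa [Metric.mem_closedBall, dist_comm, dist_eq_norm]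

section Consistency

variable {Ω E V : Type*} [MeasurableSpace Ω] [MeasurableSpace E] {P : Measure Ω}
  {G : Measure E} [IsFiniteMeasure G] [PseudoMetricSpace V]

/-- Consistency of a minimum distance estimator whose integrand is, uniformly over the parameter
set, within a small squared error `Q` of the difference `H θ₀ - H θ`. -/
lemma tendstoInMeasure_of_isArgMin {Θ : Set V} {θ₀ : V} (hθ₀ : θ₀ ∈ Θ) {H : V → E → ℝ}
    (hsep : ∀ ε : ℝ, 0 < ε → ∃ κ : ℝ, 0 < κ ∧ ∀ θ ∈ Θ, ε ≤ dist θ θ₀ →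
      ENNReal.ofReal κ ≤ ∫⁻ z, ENNReal.ofReal ((H θ₀ z - H θ z) ^ 2) ∂G)
    {Q : ℕ → Ω → E → ℝ} (hQ0 : ∀ n ω z, 0 ≤ Q n ω z)
    (hQm : ∀ n, AEMeasurable (fun p : Ω × E => Q n p.1 p.2) (P.prod G))
    (hQm' : ∀ n ω, Measurable (Q n ω))
    (hQ : Tendsto (fun n => ∫⁻ ω, ∫⁻ z, ENNReal.ofReal (Q n ω z) ∂G ∂P) atTop (𝓝 0))
    {good : ℕ → Ω → Prop} (hgood : Tendsto (fun n => P {ω | ¬ good n ω}) atTop (𝓝 0))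
    {C₁ C₂ : ℝ} (hC₁ : 0 < C₁) (hC₂ : 0 ≤ C₂) {g : ℕ → Ω → V → E → ℝ}
    (hg : ∀ e : ℝ, 0 < e → e ≤ 1 → ∀ᶠ n in atTop, ∀ ω, good n ω → ∀ θ ∈ Θ, ∀ᵐ z ∂G,
      (g n ω θ z - (H θ₀ z - H θ z)) ^ 2 ≤ C₁ * Q n ω z + C₂ * e ^ 2)
    {t : ℕ → Ω → V} (ht : ∀ᶠ n in atTop, ∀ᵐ ω ∂P,
      IsArgMin (fun θ => ∫⁻ z, ENNReal.ofReal (g n ω θ z ^ 2) ∂G) Θ (t n ω)) :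
    TendstoInMeasure P t atTop (fun _ => θ₀) := by
  set C : ℝ := 4 * (C₁ + C₂ * G.real Set.univ) with hC
  have hG0 : 0 ≤ G.real Set.univ := measureReal_nonneg
  refine tendstoInMeasure_of_separation hsep
    (T := fun n ω => ∫⁻ z, ENNReal.ofReal (Q n ω z) ∂G)
    (fun n => (hQm n).ennreal_ofReal.lintegral_prod_right') hQ hgood (C := C) (by positivity)
    fun e he he1 => ?_
  filter_upwards [hg e he he1, ht] with n hn htn
  filter_upwards [htn] with ω hω hgω
  refine ⟨hω.1, ?_⟩
  have hQmω := hQm' n ω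
  refine (lintegral_sq_sub_le_of_isArgMin hθ₀ (Q := fun z => C₁ * Q n ω z + C₂ * e ^ 2)
    (by fun_prop) (hn ω hgω) hω).trans ?_
  have h1 : ∫⁻ z, ENNReal.ofReal (C₁ * Q n ω z + C₂ * e ^ 2) ∂G
      = ENNReal.ofReal C₁ * ∫⁻ z, ENNReal.ofReal (Q n ω z) ∂G
        + ENNReal.ofReal (C₂ * G.real Set.univ) * ENNReal.ofReal (e ^ 2) := by
    have h2 : ∀ z, ENNReal.ofReal (C₁ * Q n ω z + C₂ * e ^ 2)
        = ENNReal.ofReal C₁ * ENNReal.ofReal (Q n ω z) + ENNReal.ofReal (C₂ * e ^ 2) := by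
      intro z
      rw [← ENNReal.ofReal_mul hC₁.le,
        ENNReal.ofReal_add (mul_nonneg hC₁.le (hQ0 n ω z)) (by positivity)]
    simp_rw [h2]
    rw [lintegral_add_right _ measurable_const, lintegral_const_mul _ (by fun_prop),
      lintegral_const, ENNReal.ofReal_mul hC₂, ENNReal.ofReal_mul hC₂, ofReal_measureReal]
    ring
  rw [h1, hC, ENNReal.ofReal_mul (p := 4) (by norm_num), ENNReal.ofReal_ofNat, mul_assoc,
    ENNReal.ofReal_add hC₁.le (by positivity), mul_add (_ + _)]
  gcongr
  · exact le_self_add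
  · exact le_add_self

end Consistency

theorem corollary3p1
    {d q : ℕ} (hd : 1 ≤ d) (hq : 1 ≤ q)
    {Ω : Type*} [MeasurableSpace Ω] (P : Measure Ω) [IsProbabilityMeasure P]
    -- the compact sets `I ⊆ ℝ^d`, `Θ ⊆ ℝ^q`, and the finite integrating measure `G`, carried by `I`
    (I : Set (Fin d → ℝ)) (hI : IsCompact I)
    (Θ : Set (EuclideanSpace ℝ (Fin q))) (hΘ : IsCompact Θ)
    (G : Measure (Fin d → ℝ)) [IsFiniteMeasure G] (hG : G Iᶜ = 0)
    -- the Berkson model `Y = μ(X) + ε`, `X = Z + η`; here `reg` is `μ`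
    (Z η : Ω → Fin d → ℝ) (ε : Ω → ℝ)
    (hZ : Measurable Z) (hη : Measurable η) (hε : Measurable ε)
    (hindep : MutuallyIndependent₃ P Z η ε)
    (fZ fη : (Fin d → ℝ) → ℝ)
    (hfZ : HasLebesgueDensity P Z fZ) (hfη : HasLebesgueDensity P η fη)
    (reg : (Fin d → ℝ) → ℝ) (hreg : Measurable reg)
    -- the parametric family and the null hypothesis `μ = m_θ₀` on the range of `X`
    (m : EuclideanSpace ℝ (Fin q) → (Fin d → ℝ) → ℝ) (hm : ∀ θ ∈ Θ, Measurable (m θ))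
    (θ₀ : EuclideanSpace ℝ (Fin q)) (hθ₀ : θ₀ ∈ Θ)
    (h0 : ∀ᵐ ω ∂P, reg (Z ω + η ω) = m θ₀ (Z ω + η ω))
    -- (e1): the sample `(Zᵢ, Yᵢ)` consists of i.i.d. copies of `(Z, Y)`, and `∫ H² dG < ∞`
    (Zs : ℕ → Ω → Fin d → ℝ) (Ys : ℕ → Ω → ℝ)
    (hiid : iIndepFun (fun i ω => (Zs i ω, Ys i ω)) P)
    (hident : ∀ i, IdentDistrib (fun ω => (Zs i ω, Ys i ω))
      (fun ω => (Z ω, reg (Z ω + η ω) + ε ω)) P P)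
    (he1 : ∫⁻ z, ENNReal.ofReal (condMean fη reg z ^ 2) ∂G < ⊤)
    -- (e2): `E ε = 0`, `0 < Var ε < ∞`, `E m_θ₀(X)² < ∞`, and `τ²` is `G`-a.e. continuous on `I`
    (hεmean : ∫ ω, ε ω ∂P = 0) (hεL2 : MemLp ε 2 P) (hεvar : 0 < Var[ε; P])
    (hmL2 : MemLp (fun ω => m θ₀ (Z ω + η ω)) 2 P)
    (hτ : ∀ᵐ z ∂G, ContinuousWithinAt (berksonTauSq fη (m θ₀)) I z)
    -- (f1)
    (hf1 : ∃ U, IsOpen U ∧ I ⊆ U ∧ UniformContinuousOn fZ U)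
    (hf1' : ∃ c > 0, ∀ z ∈ I, c ≤ fZ z)
    -- (m1), (m2), (m3)
    (hm1 : ∀ θ ∈ Θ, ∀ᵐ x : Fin d → ℝ, ContinuousAt (m θ) x)
    (hm2 : ∀ θ₁ ∈ Θ, ∀ θ₂ ∈ Θ,
      (∀ᵐ z ∂G, condMean fη (m θ₁) z = condMean fη (m θ₂) z) → θ₁ = θ₂)
    (hm3 : ∃ ℓ : (Fin d → ℝ) → ℝ, ContinuousOn ℓ I ∧ (∀ z ∈ I, 0 < ℓ z) ∧
      ∃ β : ℝ, 0 < β ∧ β ≤ 1 ∧ ∀ θ₁ ∈ Θ, ∀ θ₂ ∈ Θ, ∀ z ∈ I,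
        |condMean fη (m θ₂) z - condMean fη (m θ₁) z| ≤ ‖θ₂ - θ₁‖ ^ β * ℓ z)
    -- boundedness of the family, through `E[m_θ(X)² | Z = z]`, for `θ ∈ Θ` and `z` near `I`
    (hbdd : ∃ U, IsOpen U ∧ I ⊆ U ∧ ∃ B : ENNReal, B < ⊤ ∧
      ∀ θ ∈ Θ, ∀ z ∈ U, condSecondMoment fη (m θ) z ≤ B)
    -- (k)
    (K Kstar : (Fin d → ℝ) → ℝ) (hK : IsKernel K) (hKstar : IsKernel Kstar)
    (hKstarLip : ∃ L, LipschitzOnWith L Kstar (Set.Icc (-1) 1))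
    -- (h1), (h2), and the bandwidth `w_n` of the exact order `(log n / n)^{1/(d+4)}`
    (h w : ℕ → ℝ) (hhpos : ∀ᶠ n in atTop, 0 < h n) (hwpos : ∀ᶠ n in atTop, 0 < w n)
    (hh1 : Tendsto h atTop (𝓝 0))
    (hh2 : Tendsto (fun n : ℕ => (n : ℝ) * h n ^ (2 * d)) atTop atTop)
    (hw : w =Θ[atTop] fun n : ℕ => (Real.log n / n) ^ (1 / ((d : ℝ) + 4)))
    -- the minimum distance estimators
    (θstar θhat : ℕ → Ω → EuclideanSpace ℝ (Fin q))
    (hθstar : ∀ᶠ n in atTop, ∀ᵐ ω ∂P, IsArgMin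
      (fun θ => distStar K Kstar (h n) (w n) n G (fun i => Zs i ω) (fun i => Ys i ω)
        (condMean fη (m θ))) Θ (θstar n ω))
    (hθhat : ∀ᶠ n in atTop, ∀ᵐ ω ∂P, IsArgMin
      (fun θ => distHat K Kstar (h n) (w n) n G (fun i => Zs i ω) (fun i => Ys i ω)
        (condMean fη (m θ))) Θ (θhat n ω)) :
    TendstoInMeasure P θstar atTop (fun _ => θ₀) ∧
      TendstoInMeasure P θhat atTop (fun _ => θ₀) := by
  have hHm : ∀ θ ∈ Θ, Measurable (condMean fη (m θ)) :=
    fun θ hθ => measurable_condMean hfη.1 (hm θ hθ)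
  have hfηi := hfη.integrable hη
  have hfη1 := hfη.integral_eq_one hη
  have hGI : ∀ᵐ z ∂G, z ∈ I := hG
  -- The conditional second moments are at most `B` within distance `ρ₂` of `I`.
  obtain ⟨U₂, hU₂, hIU₂, B', hB', hbd⟩ := hbdd
  obtain ⟨ρ₂, hρ₂, hUρ₂⟩ := hI.exists_pos_forall_norm_sub_le_mem hU₂ hIU₂
  set B : ℝ := B'.toReal with hBdef
  have hB : 0 ≤ B := ENNReal.toReal_nonneg
  have hmB : ∀ θ ∈ Θ, ∀ z ∈ I, ∀ y, ‖z - y‖ ≤ ρ₂ →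
      condSecondMoment fη (m θ) y ≤ ENNReal.ofReal B := by
    intro θ hθ z hz y hy
    rw [hBdef, ENNReal.ofReal_toReal hB'.ne]
    exact hbd θ hθ y (hUρ₂ z hz y hy)
  have hHb : ∀ θ ∈ Θ, ∀ z ∈ I, |condMean fη (m θ) z| ≤ √B := fun θ hθ z hz =>
    Real.abs_le_sqrt (sq_condMean_le hfη.1 hfη.2.1 hfηi hfη1 (hm θ hθ) hB
      (hmB θ hθ z hz z (by simpa using hρ₂.le)))
  have hHosc : ∀ e > 0, ∃ r > 0, ∀ θ ∈ Θ, ∀ z ∈ I, ∀ y, ‖z - y‖ ≤ r →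
      |condMean fη (m θ) y - condMean fη (m θ) z| ≤ e := by
    intro e he
    obtain ⟨r, hr, hr'⟩ := condMean_equicontinuous hfη.1 hfη.2.1 hfηi hB he
    refine ⟨min r ρ₂, lt_min hr hρ₂, fun θ hθ z hz y hy => ?_⟩
    exact hr' (m θ) z y (hm θ hθ) (hy.trans (min_le_left _ _))
      (hmB θ hθ z hz z (by simpa using hρ₂.le)) (hmB θ hθ z hz y (hy.trans (min_le_right _ _)))
  -- Uniform continuity of `fZ` near `I` bounds its oscillation around points of `I`, and extends the
  -- bounds `c ≤ fZ ≤ F₀` on `I`, up to constants, to a neighbourhood.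
  obtain ⟨U₁, hU₁, hIU₁, hfU⟩ := hf1
  obtain ⟨ρ₁, hρ₁, hUρ₁⟩ := hI.exists_pos_forall_norm_sub_le_mem hU₁ hIU₁
  have hfosc : ∀ e > 0, ∃ r > 0, ∀ z ∈ I, ∀ y, ‖z - y‖ ≤ r → |fZ y - fZ z| ≤ e := by
    intro e he
    obtain ⟨δ, hδ, hδ'⟩ := Metric.uniformContinuousOn_iff.1 hfU e he
    refine ⟨min (δ / 2) ρ₁, lt_min (by positivity) hρ₁, fun z hz y hy => ?_⟩
    have hd : dist y z < δ := by
      rw [dist_comm, dist_eq_norm]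
      linarith [hy.trans (min_le_left _ _)]
    exact (hδ' y (hUρ₁ z hz y (hy.trans (min_le_right _ _))) z (hIU₁ hz) hd).le
  obtain ⟨F₀, hF₀⟩ := hI.exists_bound_of_continuousOn (hfU.continuousOn.mono hIU₁)
  have hFI : ∀ z ∈ I, fZ z ≤ F₀ := fun z hz => (le_abs_self _).trans (hF₀ z hz)
  obtain ⟨r₁, hr₁, hr₁'⟩ := hfosc 1 one_pos
  obtain ⟨c, hc, hcI⟩ := hf1'
  obtain ⟨r₂, hr₂, hr₂'⟩ := hfosc (c / 2) (by positivity)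
  have hclow : ∀ z ∈ I, ∀ y, ‖z - y‖ ≤ r₂ → c / 2 ≤ fZ y := fun z hz y hy => by
    linarith [(abs_le.1 (hr₂' z hz y hy)).1, hcI z hz]
  -- Under the null hypothesis the sample is distributed as `(Z, m θ₀ (Z + η) + ε)`.
  have hmθ₀ := hm θ₀ hθ₀
  have hid : ∀ i, IdentDistrib (fun ω => (Zs i ω, Ys i ω))
      (fun ω => (Z ω, m θ₀ (Z ω + η ω) + ε ω)) P P := fun i => (hident i).trans
    (IdentDistrib.of_ae_eq (hident i).aemeasurable_snd (by
      filter_upwards [h0] with ω hω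
      rw [hω]))
  have hZs : ∀ i, AEMeasurable (Zs i) P := fun i => (hid i).aemeasurable_fst.fst
  have hYs : ∀ i, AEMeasurable (Ys i) P := fun i => (hid i).aemeasurable_fst.snd
  have hindZ : iIndepFun Zs P := hiid.comp (fun _ p => p.1) fun _ => measurable_fst
  have hidZ : ∀ i, IdentDistrib (Zs i) Z P P := fun i => (hid i).comp measurable_fst
  obtain ⟨L, hL⟩ := hKstarLip
  obtain ⟨c₀, hc₀, hgood⟩ := exists_tendsto_measure_not_lt_kernelDensityEstimator hZ hfZ hindZ hidZ
    hKstar hL.continuousOn hwpos hw hI.isBounded (half_pos hc) hr₂ hclow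
  have hTlim := tendsto_lintegral_kernelErrors (G := G) hZ hη hε hindep hfZ hfη hmθ₀ hεmean hεL2
    hiid hid hK hKstar hhpos hwpos hh1 (tendsto_zero_of_isTheta_log hw)
    (tendsto_natCast_mul_pow_atTop_of_two_mul hhpos hh1 hh2)
    (tendsto_natCast_mul_pow_atTop_of_isTheta_log hwpos hw) hGI hB (lt_min hr₁ hρ₂) (F := F₀ + 1)
    (fun z hz y hy => by
      linarith [(abs_le.1 (hr₁' z hz y (hy.trans (min_le_left _ _)))).2, hFI z hz])
    (fun z hz y hy => hmB θ₀ hθ₀ z hz y (hy.trans (min_le_right _ _))) hfosc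
  have hsep : ∀ e : ℝ, 0 < e → ∃ κ : ℝ, 0 < κ ∧ ∀ θ ∈ Θ, e ≤ dist θ θ₀ → ENNReal.ofReal κ ≤
      ∫⁻ z, ENNReal.ofReal ((condMean fη (m θ₀) z - condMean fη (m θ) z) ^ 2) ∂G := by
    intro e he
    refine exists_separation (H := fun θ => condMean fη (m θ)) hΘ
      (fun θ hθ => (hHm θ hθ).aestronglyMeasurable)
      (fun θ hθ => hGI.mono fun z hz => hHb θ hθ z hz) hθ₀ (hGI.mono fun z hz => ?_)
      (fun θ hθ h => hm2 θ₀ hθ₀ θ hθ h) he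
    obtain ⟨ℓ, -, -, β, hβ, -, hm3'⟩ := hm3
    intro θ hθ
    rw [ContinuousWithinAt, tendsto_iff_dist_tendsto_zero]
    have hlim : Tendsto (fun θ' => ‖θ' - θ‖ ^ β * ℓ z) (𝓝[Θ] θ) (𝓝 0) := by
      have h1 : Continuous fun θ' : EuclideanSpace ℝ (Fin q) => ‖θ' - θ‖ ^ β * ℓ z :=
        ((continuous_id.sub continuous_const).norm.rpow_const fun _ => Or.inr hβ.le).mul_const _
      have h2 := (h1.tendsto θ).mono_left (nhdsWithin_le_nhds (s := Θ))
      simpa [Real.zero_rpow hβ.ne'] using h2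
    refine squeeze_zero' (Eventually.of_forall fun _ => dist_nonneg) ?_ hlim
    filter_upwards [self_mem_nhdsWithin] with θ' hθ'
    exact hm3' θ hθ θ' hθ' z hz
  -- `b` bounds both `H θ₀` and the differences `H θ₀ - H θ` on `I`.
  set b : ℝ := 2 * √B with hb
  have hbB : √B ≤ b := by linarith [Real.sqrt_nonneg B]
  have hconsistent := fun (g : ℕ → Ω → EuclideanSpace ℝ (Fin q) → (Fin d → ℝ) → ℝ) hg
      (t : ℕ → Ω → EuclideanSpace ℝ (Fin q)) ht =>
    tendstoInMeasure_of_isArgMin (P := P) (H := fun θ => condMean fη (m θ)) hθ₀ hsep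
    (fun n ω z => kernelErrors_nonneg K Kstar (h n) (w n) n (fun i => Zs i ω) (fun i => Ys i ω)
      (condMean fη (m θ₀)) fZ z)
    (fun n => aemeasurable_kernelErrors G hK hKstar (h n) (w n) n hZs hYs (hHm θ₀ hθ₀) hfZ.1)
    (fun n ω => measurable_kernelErrors hK hKstar (h n) (w n) n _ _ _ hfZ.1) hTlim hgood
    (C₁ := 4 * (1 + b) ^ 2 / c₀ ^ 2) (C₂ := 4 * F₀ ^ 2 / c₀ ^ 2) (by positivity) (by positivity)
    (g := g) hg (t := t) ht
  constructor
  · refine hconsistent (fun n ω θ z => kernelAverage K (h n) n (fun i => Zs i ω)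
      (fun i => Ys i ω) z / kernelDensityEstimator Kstar (w n) n (fun i => Zs i ω) z
        - condMean fη (m θ) z) (fun e he he1 => ?_) _ hθstar
    obtain ⟨r, hr, hr'⟩ := hHosc e he
    filter_upwards [hhpos, hh1.eventually_le_const hr] with n hn hnr ω hω θ hθ
    filter_upwards [hGI] with z hz
    have hT := hK.abs_kernelAverage_sub_le hn n (fun i => Zs i ω)
      (fun y hy => hr' θ₀ hθ₀ z hz y (hy.trans hnr))
    have hmain := sq_ratio_sub_le (S := kernelAverage K (h n) n (fun i => Zs i ω)
      (fun i => Ys i ω - condMean fη (m θ₀) (Zs i ω)) z) hc₀ (hω z hz) hT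
      ((hHb θ₀ hθ₀ z hz).trans hbB) (hFI z hz) he.le he1
    -- `Yᵢ = (Yᵢ - H₀(Zᵢ)) + H₀(Zᵢ)`
    rw [← kernelAverage_add] at hmain
    simp only [sub_add_cancel] at hmain
    refine le_trans (le_of_eq ?_) hmain
    ring
  · refine hconsistent (fun n ω θ z => kernelAverage K (h n) n (fun i => Zs i ω)
      (fun i => Ys i ω - condMean fη (m θ) (Zs i ω)) z
        / kernelDensityEstimator Kstar (w n) n (fun i => Zs i ω) z) (fun e he he1 => ?_) _ hθhat
    obtain ⟨r, hr, hr'⟩ := hHosc (e / 2) (by positivity)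
    filter_upwards [hhpos, hh1.eventually_le_const hr] with n hn hnr ω hω θ hθ
    filter_upwards [hGI] with z hz
    have hT := hK.abs_kernelAverage_sub_le hn n (fun i => Zs i ω)
      (φ := fun y => condMean fη (m θ₀) y - condMean fη (m θ) y)
      (v := condMean fη (m θ₀) z - condMean fη (m θ) z) (e := e) (z := z) (fun y hy => by
        have h1 := abs_le.1 (hr' θ₀ hθ₀ z hz y (hy.trans hnr))
        have h2 := abs_le.1 (hr' θ hθ z hz y (hy.trans hnr))
        exact abs_le.2 ⟨by linarith [h1.1, h2.2], by linarith [h1.2, h2.1]⟩)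
    have hv : |condMean fη (m θ₀) z - condMean fη (m θ) z| ≤ b :=
      (abs_sub _ _).trans (by linarith [hHb θ₀ hθ₀ z hz, hHb θ hθ z hz])
    have hmain := sq_ratio_sub_le (S := kernelAverage K (h n) n (fun i => Zs i ω)
      (fun i => Ys i ω - condMean fη (m θ₀) (Zs i ω)) z) hc₀ (hω z hz) hT hv (hFI z hz) he.le he1
    -- `Yᵢ - H θ (Zᵢ) = (Yᵢ - H₀(Zᵢ)) + (H₀(Zᵢ) - H θ (Zᵢ))`
    rw [← kernelAverage_add] at hmain
    simp only [sub_add_sub_cancel] at hmain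
    exact hmain
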